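/- Let $F=\mathbb{Q}(\alpha)$ be the field of rational functions in an indeterminate $\alpha$, and let $\Lambda_F=F[p_1,p_2,p_3,\dots]$ be the ring of symmetric functions over $F$ in variables $x_1,x_2,\dots$, where $p_k=\sum_i x_i^k$. For a partition $\lambda=(\lambda_1\ge\lambda_2\ge\cdots)$ let $m_\lambda$ be the monomial symmetric function (the sum of all distinct monomials in the $x_i$ with exponents $\lambda_1,\lambda_2,\dots$ in some order), $l(\lambda)$ the number of nonzero parts of $\lambda$, $p_\lambda=p_{\lambda_1}\cdots p_{\lambda_{l(\lambda)}}$, and $z_\lambda=\prod_{i\ge1}i^{m_i}m_i!$, where $m_i$ is the number of parts of $\lambda$ equal to $i$. For partitions of the same weight, $\mu\le\lambda$ denotes dominance order: $\mu_1+\cdots+\mu_i\le\lambda_1+\cdots+\lambda_i$ for all $i$. Equip $\Lambda_F$ with the $F$-bilinear form $\langle p_\lambda,p_\mu\rangle=\delta_{\lambda\mu}\,\alpha^{l(\lambda)}z_\lambda$. The Jack symmetric functions $P_\lambda(\alpha)\in\Lambda_F$ are the family, indexed by all partitions, defined by $$P_\lambda(\alpha)=\sum_{\mu\le\lambda}c_{\lambda\mu}(\alpha)\,m_\mu,\quad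 c_{\lambda\mu}(\alpha)\in F,\ c_{\lambda\lambda}(\alpha)=1,\qquad \langle P_\lambda(\alpha),P_\mu(\alpha)\rangle=0\ \text{ for }\lambda\ne\mu .$$ Let $D(\alpha)$ be the $F$-linear operator on $\Lambda_F$ $$D(\alpha)=\sum_{i,j\ge1}(i+j)\alpha\,p_ip_j\frac{\partial}{\partial p_{i+j}}+\sum_{i,j\ge1}ij\alpha^2\,p_{i+j}\frac{\partial^2}{\partial p_i\partial p_j}+\alpha(\alpha-1)\sum_{k\ge1}k^2p_k\frac{\partial}{\partial p_k}.$$ **Theorem.** There is exactly one such family, so that the $P_\lambda(\alpha)$ are well defined. For every partition $\lambda$ and every $P'_\lambda\in\Lambda_F$, one has $P'_\lambda=P_\lambda(\alpha)$ if and only if both of the following hold: 1. there are $D_{\lambda\mu}(\alpha)\in F$ with $D_{\lambda\lambda}(\alpha)=1$ such that $P'_\lambda=\sum_{\mu\le\lambda}D_{\lambda\mu}(\alpha)\,m_\mu$; 2. $P'_\lambda$ is an eigenvector of $D(\alpha)$. -/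

import Mathlib

namespace JackSym

/-- The field `F = ℚ(α)` of rational functions in one indeterminate. -/
abbrev F : Type := RatFunc ℚ

/-- The indeterminate `α`. -/
noncomputable def α : F := RatFunc.X

/-- The graded ring `Λ_F` of symmetric functions over `F = ℚ(α)`, presented as the polynomial ring
`F[p₁, p₂, p₃, …]` in the power sums. The variable `X k` is the power sum `p_k`, `k ≥ 1`, and
`toSeries` below gives the underlying formal power series in `x₀, x₁, x₂, …`. -/
abbrev SymFun : Type := MvPolynomial ℕ+ F

/-- The power sum `p_k` as an element of `SymFun`. -/
noncomputable abbrev p (k : ℕ+) : SymFun := MvPolynomial.X k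

/-- The operator `∂/∂p_k` on `SymFun`. -/
noncomputable abbrev dp (k : ℕ+) (f : SymFun) : SymFun := MvPolynomial.pderiv k f

/-! ### Formal power series in the variables `x₀, x₁, x₂, …` -/

open Classical in
/-- The power sum `x₀ ^ k + x₁ ^ k + x₂ ^ k + ⋯` as a formal power series: the monomials that occur
are those of the form `x_i ^ k`, each with coefficient `1`. -/
noncomputable def powerSumSeries (k : ℕ+) : MvPowerSeries ℕ F :=
  fun d => if ∃ i : ℕ, d = Finsupp.single i (k : ℕ) then 1 else 0

/-- The symmetric formal power series in `x₀, x₁, x₂, …` that an element of `F[p₁, p₂, …]` stands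
for: the `F`-algebra homomorphism that sends `p_k` to the `k`-th power sum of the `x_i`. -/
noncomputable def toSeries : SymFun →ₐ[F] MvPowerSeries ℕ F :=
  MvPolynomial.aeval powerSumSeries

open Classical in
/-- The monomial symmetric function `m_μ`: the sum of all distinct monomials in `x₀, x₁, x₂, …`
whose nonzero exponents are, with multiplicity, the parts of `μ`. -/
noncomputable def monomialSymm {n : ℕ} (μ : n.Partition) : MvPowerSeries ℕ F :=
  fun d => if d.support.val.map d = μ.parts then 1 else 0

/-! ### Dominance order -/

/-- The sum `μ₁ + ⋯ + μ_i` of the `i` largest parts of a partition (missing parts count as `0`). -/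
def partialSum {n : ℕ} (μ : n.Partition) (i : ℕ) : ℕ :=
  ((μ.parts.sort (· ≥ ·)).take i).sum

/-- Dominance order on the partitions of `n`: `μ ≤ lam`. -/
def DomLE {n : ℕ} (μ lam : n.Partition) : Prop :=
  ∀ i : ℕ, partialSum μ i ≤ partialSum lam i

open Classical in
/-- `f = ∑_{μ ≤ lam} c_{lam, μ} m_μ` for some `c_{lam, μ} ∈ ℚ(α)` with `c_{lam, lam} = 1`. -/
def IsUnitriangular {n : ℕ} (lam : n.Partition) (f : SymFun) : Prop :=
  ∃ c : n.Partition → F, c lam = 1 ∧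
    toSeries f = ∑ μ : n.Partition with DomLE μ lam, c μ • monomialSymm μ

/-! ### The Jack scalar product and Jack symmetric functions -/

/-- `z_d = ∏_i i ^ {m_i} m_i!` for the partition `(1^{m₁} 2^{m₂} ⋯)`, given by `d i = m_i`. -/
def zee (d : ℕ+ →₀ ℕ) : ℕ :=
  d.prod fun i m => (i : ℕ) ^ m * m.factorial

/-- The Jack scalar product: the bilinear form on `Λ_F` with
`⟨p_λ, p_μ⟩ = δ_{λ, μ} α ^ {l(λ)} z_λ`. The product `p_λ` of power sums is the monomial with
exponent vector `d i = m_i(λ)`, so that `l(λ) = ∑ i, d i` is `d.degree`. -/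
noncomputable def jackInner (f g : SymFun) : F :=
  ∑ d ∈ f.support, f.coeff d * g.coeff d * (α ^ d.degree * (zee d : F))

/-- The set of all partitions, of all weights. -/
abbrev AllPartitions : Type := Σ n : ℕ, n.Partition

/-- The defining properties of the Jack symmetric functions `P_λ(α)`: they are unitriangular in the
monomial basis for the dominance order, and pairwise orthogonal. -/
structure IsJackFamily (P : AllPartitions → SymFun) : Prop where
  unitriangular : ∀ lam : AllPartitions, IsUnitriangular lam.2 (P lam)
  orthogonal : ∀ lam μ : AllPartitions, lam ≠ μ → jackInner (P lam) (P μ) = 0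

/-! ### The Laplace-Beltrami type operator `D(α)` -/

/-- The term `(i + j) α p_i p_j ∂f/∂p_{i+j}`. -/
noncomputable def splitTerm (f : SymFun) (ij : ℕ+ × ℕ+) : SymFun :=
  ((((ij.1 + ij.2 : ℕ+) : ℕ) : F) * α) • (p ij.1 * p ij.2 * dp (ij.1 + ij.2) f)

/-- The term `i j α² p_{i+j} ∂²f/∂p_i∂p_j`. -/
noncomputable def joinTerm (f : SymFun) (ij : ℕ+ × ℕ+) : SymFun :=
  (((ij.1 : ℕ) : F) * ((ij.2 : ℕ) : F) * α ^ 2) • (p (ij.1 + ij.2) * dp ij.1 (dp ij.2 f))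

/-- The term `k² p_k ∂f/∂p_k`. -/
noncomputable def diagTerm (f : SymFun) (k : ℕ+) : SymFun :=
  (((k : ℕ) : F) ^ 2) • (p k * dp k f)

theorem splitTerm_finite (f : SymFun) : (Function.support (splitTerm f)).Finite := by
  have h : (⋃ n ∈ f.vars, {ij : ℕ+ × ℕ+ | ij.1 + ij.2 = n}).Finite := by
    refine Set.Finite.biUnion f.vars.finite_toSet fun n _ => ?_
    refine ((Set.finite_Iic n).prod (Set.finite_Iic n)).subset ?_
    rintro ⟨i, j⟩ h
    simp only [Set.mem_ofPred_eq] at h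
    subst h
    exact ⟨(PNat.lt_add_right i j).le, (PNat.lt_add_left j i).le⟩
  refine h.subset fun ij hij => ?_
  simp only [Set.mem_iUnion, Set.mem_ofPred_eq, exists_prop, exists_eq_right']
  by_contra hv
  exact hij (by simp [splitTerm, dp, MvPolynomial.pderiv_eq_zero_of_notMem_vars hv])

theorem dp_comm (i j : ℕ+) (f : SymFun) : dp i (dp j f) = dp j (dp i f) := by
  have h : ⁅(MvPolynomial.pderiv i : Derivation F SymFun SymFun), (MvPolynomial.pderiv j : Derivation F SymFun SymFun)⁆ = 0 := by
    refine MvPolynomial.derivation_ext fun k => ?_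
    simp only [Derivation.commutator_apply, MvPolynomial.pderiv_X, Derivation.zero_apply]
    simp [Pi.single_apply, apply_ite]
  have := congrArg (fun d => d f) h
  simpa [Derivation.commutator_apply, sub_eq_zero] using this

theorem joinTerm_finite (f : SymFun) : (Function.support (joinTerm f)).Finite := by
  refine (f.vars.finite_toSet.prod f.vars.finite_toSet).subset fun ij hij => ?_
  refine ⟨?_, ?_⟩
  · by_contra hv
    exact hij (by simp [joinTerm, dp_comm ij.1 ij.2, dp,
      MvPolynomial.pderiv_eq_zero_of_notMem_vars hv])
  · by_contra hv
    exact hij (by simp [joinTerm, dp, MvPolynomial.pderiv_eq_zero_of_notMem_vars hv])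

theorem diagTerm_finite (f : SymFun) : (Function.support (diagTerm f)).Finite := by
  refine f.vars.finite_toSet.subset fun k hk => ?_
  by_contra hv
  exact hk (by simp [diagTerm, dp, MvPolynomial.pderiv_eq_zero_of_notMem_vars hv])

/-- The operator
`D(α) = ∑_{i,j ≥ 1} (i + j) α p_i p_j ∂/∂p_{i+j} + ∑_{i,j ≥ 1} i j α² p_{i+j} ∂²/∂p_i∂p_j
  + α (α - 1) ∑_{k ≥ 1} k² p_k ∂/∂p_k`
on `Λ_F`. Applied to a given element, each sum has only finitely many nonzero terms
(`splitTerm_finite`, `joinTerm_finite`, `diagTerm_finite`). -/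
noncomputable def D : Module.End F SymFun where
  toFun f := (∑ᶠ ij, splitTerm f ij) + (∑ᶠ ij, joinTerm f ij) + (α * (α - 1)) • ∑ᶠ k, diagTerm f k
  map_add' f g := by
    have h1 : splitTerm (f + g) = fun ij => splitTerm f ij + splitTerm g ij := by
      funext ij; simp [splitTerm, dp, mul_add]
    have h2 : joinTerm (f + g) = fun ij => joinTerm f ij + joinTerm g ij := by
      funext ij; simp [joinTerm, dp, mul_add]
    have h3 : diagTerm (f + g) = fun k => diagTerm f k + diagTerm g k := by
      funext k; simp [diagTerm, dp, mul_add]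
    rw [h1, h2, h3, finsum_add_distrib (splitTerm_finite f) (splitTerm_finite g),
      finsum_add_distrib (joinTerm_finite f) (joinTerm_finite g),
      finsum_add_distrib (diagTerm_finite f) (diagTerm_finite g), smul_add]
    abel
  map_smul' a f := by
    have h1 : splitTerm (a • f) = fun ij => a • splitTerm f ij := by
      funext ij; simp [splitTerm, dp, smul_comm a]
    have h2 : joinTerm (a • f) = fun ij => a • joinTerm f ij := by
      funext ij; simp [joinTerm, dp, smul_comm a]
    have h3 : diagTerm (a • f) = fun k => a • diagTerm f k := by
      funext k; simp [diagTerm, dp, smul_comm a]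
    rw [h1, h2, h3, ← smul_finsum, ← smul_finsum, ← smul_finsum]
    simp [smul_add, smul_comm a]

end JackSym

namespace JackSym

/-! ### Dominance of multisets -/

/-! The Jack functions are constructed as joint eigenvectors of a family of self-adjoint operators
that are triangular for dominance, one of which is `D`. Dominance is only a partial order, so
Gram–Schmidt alone does not give an orthogonal family: nothing forces the functions of two
incomparable partitions to be orthogonal. The family of operators repairs this, because its joint
eigenvalues separate all partitions.

The operators are the moments of the Nazarov–Sklyanin operator `lax` on `Λ_F[w]`: `moment k` applies
`lax ^ k` to `Λ_F · w ^ 0` and takes the coefficient of `w ^ 0`. Multiplication by `p_n` is adjoint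
to `α n ∂/∂p_n`, and in `lax` the first accompanies `w ^ a ↦ w ^ (a - n)`, the second the reverse.
Hence `lax`, and with it every moment, is self-adjoint (`polyForm_lax`). Expanding the third moment
gives `D` (`D_eq_moment`).

Triangularity is seen in the variables `x_i`. Under `w ↦ x₀` the operator `lax` becomes the Dunkl
operator `α x₀ ∂/∂x₀ + ∑_j x_j / (x₀ - x_j) (1 - s_j)` (`polySeries_lax`), and taking the
coefficient of `w ^ 0` becomes looking at monomials free of `x₀`. The Dunkl operator is triangular,
with diagonal entries given by an explicit recursion (`IsTriangular.dunkl`). For `k ≥ 1` the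
coefficient of `α ^ k` in the eigenvalue of `moment (k + 1)` at `λ` is `∑ λ_i ^ k`, and these power
sums determine `λ`. For `k = 2` the sum strictly increases along dominance, so `D` alone already
separates comparable partitions.

The rest is linear algebra over an anisotropic form (`jackForm_anisotropic`): a vector in the span
of lower terms that is orthogonal to all lower Jack functions is zero. This gives the eigenvector
equation, the uniqueness of the family, and the characterization by `D`. -/

theorem exists_le_map_eq {ι β : Type*} (f : ι → β) (s : Multiset ι) (t : Multiset β)
    (h : t ≤ s.map f) : ∃ u ≤ s, u.map f = t := by
  induction s using Quotient.inductionOn with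
  | _ l =>
    induction t using Quotient.inductionOn with
    | _ m =>
      obtain ⟨m', hm, hs⟩ : m.Subperm (l.map f) := h
      obtain ⟨l', hl', rfl⟩ := List.sublist_map_iff.1 hs
      exact ⟨(l' : Multiset ι), hl'.subperm, by simpa using hm⟩

/-- The sum of the `i` largest elements of a multiset. -/
def topSum (s : Multiset ℕ) (i : ℕ) : ℕ := ((s.sort (· ≥ ·)).take i).sum

/-- Dominance order on multisets with the same sum. -/
def Dom (s t : Multiset ℕ) : Prop := s.sum = t.sum ∧ ∀ i, topSum s i ≤ topSum t i

theorem Dom.refl (s : Multiset ℕ) : Dom s s := ⟨rfl, fun _ => le_rfl⟩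

theorem Dom.trans {s t u : Multiset ℕ} (h : Dom s t) (h' : Dom t u) : Dom s u :=
  ⟨h.1.trans h'.1, fun i => (h.2 i).trans (h'.2 i)⟩

theorem domLE_iff {n : ℕ} (μ lam : n.Partition) : DomLE μ lam ↔ Dom μ.parts lam.parts :=
  ⟨fun h => ⟨μ.parts_sum.trans lam.parts_sum.symm, h⟩, fun h => h.2⟩

theorem sum_take_succ_le (a : ℕ) (l : List ℕ) (h : ∀ x ∈ l, x ≤ a) (j : ℕ) :
    (l.take (j + 1)).sum ≤ a + (l.take j).sum := by
  rw [List.take_add_one, List.sum_append, add_comm]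
  gcongr
  cases hl : l[j]? with
  | none => simp
  | some x => simpa using h x (List.mem_of_getElem? hl)

theorem sum_sublist_le_sum_take {l l' : List ℕ} (hl : l.Pairwise (· ≥ ·)) (h : l'.Sublist l)
    (i : ℕ) (hi : l'.length ≤ i) : l'.sum ≤ (l.take i).sum := by
  induction h generalizing i with
  | slnil => simp
  | @cons l₁ l₂ a h ih =>
    rw [List.pairwise_cons] at hl
    refine (ih hl.2 i hi).trans ?_
    cases i with
    | zero => simp
    | succ j => simpa using sum_take_succ_le a l₂ hl.1 j
  | @cons_cons l₁ l₂ a h ih =>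
    rw [List.pairwise_cons] at hl
    cases i with
    | zero => simp at hi
    | succ j => simpa using ih hl.2 j (by simpa using hi)

/-- Together with `exists_sum_eq_topSum` this exhibits `topSum s i` as a maximum over submultisets
of size at most `i`, so that dominance can later be tested without sorting. -/
theorem sum_le_topSum {s t : Multiset ℕ} (h : t ≤ s) (i : ℕ) (hi : t.card ≤ i) :
    t.sum ≤ topSum s i := by
  have h1 : (t.sort (· ≥ ·)).Sublist (s.sort (· ≥ ·)) := by
    refine List.sublist_of_subperm_of_pairwise (r := (· ≥ ·)) ?_ (Multiset.pairwise_sort ..)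
      (Multiset.pairwise_sort ..)
    rw [← Multiset.coe_le, Multiset.sort_eq, Multiset.sort_eq]
    exact h
  have := sum_sublist_le_sum_take (Multiset.pairwise_sort s (· ≥ ·)) h1 i (by simpa using hi)
  rwa [← Multiset.sum_coe, Multiset.sort_eq] at this

theorem exists_sum_eq_topSum (s : Multiset ℕ) (i : ℕ) :
    ∃ t ≤ s, t.card ≤ i ∧ t.sum = topSum s i := by
  refine ⟨((s.sort (· ≥ ·)).take i : List ℕ), ?_, by simp, rfl⟩
  conv_rhs => rw [← Multiset.sort_eq s (· ≥ ·)]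
  exact (List.take_sublist _ _).subperm

/-- The `j`-th largest element of a multiset, or `0`. -/
def nthLargest (s : Multiset ℕ) (j : ℕ) : ℕ := (s.sort (· ≥ ·)).getD j 0

theorem sum_range_getD (l : List ℕ) (f : ℕ → ℕ) (hf : f 0 = 0) (N : ℕ) :
    ∑ j ∈ Finset.range N, f (l.getD j 0) = ((l.take N).map f).sum := by
  induction N with
  | zero => simp
  | succ N ih =>
    rw [Finset.sum_range_succ, ih, List.take_add_one, List.map_append, List.sum_append]
    congr 1
    cases hl : l[N]? <;> simp [List.getD, hl, hf]

theorem sum_range_nthLargest (s : Multiset ℕ) (N : ℕ) :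
    ∑ j ∈ Finset.range N, nthLargest s j = topSum s N := by
  have := sum_range_getD (s.sort (· ≥ ·)) id rfl N
  rwa [List.map_id] at this

theorem sum_range_sq_nthLargest (s : Multiset ℕ) (N : ℕ) (hN : s.card ≤ N) :
    ∑ j ∈ Finset.range N, nthLargest s j ^ 2 = (s.map (· ^ 2)).sum := by
  have := sum_range_getD (s.sort (· ≥ ·)) (· ^ 2) rfl N
  rw [List.take_of_length_le (by simpa using hN)] at this
  rw [← Multiset.sum_coe, ← Multiset.map_coe, Multiset.sort_eq] at this
  exact this

theorem nthLargest_antitone (s : Multiset ℕ) (j : ℕ) : nthLargest s (j + 1) ≤ nthLargest s j := by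
  have h := Multiset.pairwise_sort s (· ≥ ·)
  unfold nthLargest
  set l := s.sort (· ≥ ·)
  by_cases hj : j + 1 < l.length
  · rw [List.getD_eq_getElem _ _ hj, List.getD_eq_getElem _ _ (by omega)]
    exact List.pairwise_iff_getElem.1 h j (j + 1) (by omega) hj (by omega)
  · rw [List.getD_eq_default _ _ (by omega)]
    exact Nat.zero_le _

/-- Since no part is zero, the padding value `0` of `nthLargest` marks exactly the end of the sorted
list. -/
theorem eq_of_nthLargest_eq {s t : Multiset ℕ} (hs : 0 ∉ s) (ht : 0 ∉ t)
    (h : ∀ j, nthLargest s j = nthLargest t j) : s = t := by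
  rw [← Multiset.sort_eq s (· ≥ ·), ← Multiset.sort_eq t (· ≥ ·)]
  congr 1
  have hs' : 0 ∉ s.sort (· ≥ ·) := by simpa using hs
  have ht' : 0 ∉ t.sort (· ≥ ·) := by simpa using ht
  unfold nthLargest at h
  refine List.ext_getElem? fun j => ?_
  have hj := h j
  rw [List.getD, List.getD] at hj
  cases h1 : (s.sort (· ≥ ·))[j]? <;> cases h2 : (t.sort (· ≥ ·))[j]? <;>
    simp only [h1, h2, Option.getD_none, Option.getD_some] at hj
  · rfl
  · subst hj
    exact absurd (List.mem_of_getElem? h2) ht'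
  · subst hj
    exact absurd (List.mem_of_getElem? h1) hs'
  · rw [hj]

/-- Abel summation: decreasing weights against nonnegative partial sums. -/
theorem mul_sum_le_sum_mul (x : ℕ → ℕ) (z : ℕ → ℤ) (hx : ∀ j, x (j + 1) ≤ x j)
    (hz : ∀ N, 0 ≤ ∑ j ∈ Finset.range N, z j) (N : ℕ) :
    x N * ∑ j ∈ Finset.range (N + 1), z j ≤ ∑ j ∈ Finset.range (N + 1), x j * z j := by
  induction N with
  | zero => simp
  | succ N ih =>
    rw [Finset.sum_range_succ _ (N + 1), Finset.sum_range_succ _ (N + 1)]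
    have h1 : (x (N + 1) : ℤ) ≤ x N := by exact_mod_cast hx N
    have h2 := mul_le_mul_of_nonneg_right h1 (hz (N + 1))
    linarith

/-- With sorted parts `x` and `y`, `∑ y² - ∑ x² = ∑ (y - x)² + 2 ∑ x (y - x)`; the first sum is
positive, and the second is nonnegative by Abel summation. -/
theorem sum_sq_lt_of_dom {s t : Multiset ℕ} (hs : 0 ∉ s) (ht : 0 ∉ t) (h : Dom s t)
    (hne : s ≠ t) : (s.map (· ^ 2)).sum < (t.map (· ^ 2)).sum := by
  obtain ⟨j, hj⟩ : ∃ j, nthLargest s j ≠ nthLargest t j := by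
    by_contra! hc
    exact hne (eq_of_nthLargest_eq hs ht hc)
  set x := nthLargest s
  set y := nthLargest t
  -- Large enough that the first `N + 1` terms exhaust both multisets and include the index `j`
  -- where they differ.
  set N := s.card + t.card + j
  rw [← sum_range_sq_nthLargest s (N + 1) (by omega), ← sum_range_sq_nthLargest t (N + 1) (by omega)]
  have h1 := mul_sum_le_sum_mul x (fun j => (y j : ℤ) - x j) (nthLargest_antitone s) (fun M => by
    have := h.2 M
    rw [← sum_range_nthLargest, ← sum_range_nthLargest] at this
    rw [Finset.sum_sub_distrib, sub_nonneg]
    exact_mod_cast this) N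
  have h2 : 0 ≤ (x N : ℤ) * ∑ j ∈ Finset.range (N + 1), ((y j : ℤ) - x j) := by
    refine mul_nonneg (by positivity) ?_
    have := h.2 (N + 1)
    rw [← sum_range_nthLargest, ← sum_range_nthLargest] at this
    rw [Finset.sum_sub_distrib, sub_nonneg]
    exact_mod_cast this
  have h3 : 0 < ∑ j ∈ Finset.range (N + 1), ((y j : ℤ) - x j) ^ 2 := by
    refine Finset.sum_pos' (fun _ _ => sq_nonneg _) ⟨j, by simp; omega, ?_⟩
    have : (y j : ℤ) - x j ≠ 0 := by
      rw [sub_ne_zero]; exact_mod_cast hj.symm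
    positivity
  have h4 : ∑ j ∈ Finset.range (N + 1), (y j : ℤ) ^ 2 - ∑ j ∈ Finset.range (N + 1), (x j : ℤ) ^ 2
      = ∑ j ∈ Finset.range (N + 1), ((y j : ℤ) - x j) ^ 2
        + 2 * ∑ j ∈ Finset.range (N + 1), (x j : ℤ) * ((y j : ℤ) - x j) := by
    rw [Finset.mul_sum, ← Finset.sum_sub_distrib, ← Finset.sum_add_distrib]
    exact Finset.sum_congr rfl fun _ _ => by ring
  have h5 : ∑ j ∈ Finset.range (N + 1), (x j : ℤ) ^ 2 < ∑ j ∈ Finset.range (N + 1), (y j : ℤ) ^ 2 := by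
    linarith
  exact_mod_cast h5

theorem Dom.antisymm {s t : Multiset ℕ} (hs : 0 ∉ s) (ht : 0 ∉ t) (h : Dom s t) (h' : Dom t s) :
    s = t := by
  by_contra hne
  have h1 := sum_sq_lt_of_dom hs ht h hne
  have h2 := sum_sq_lt_of_dom ht hs h' (Ne.symm hne)
  omega

/-- Equal power sums give equal sums of `v * q(v)` for every polynomial `q`; a `q` that vanishes at
all elements but one isolates the multiplicity of that element. The factor `v` is there because only
exponents `k ≥ 1` are available, and it is harmless because zero is not an element. -/
theorem eq_of_sum_pow_eq {s t : Multiset ℕ} (hs : 0 ∉ s) (ht : 0 ∉ t)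
    (h : ∀ k ≥ 1, (s.map (fun v : ℕ => (v : ℚ) ^ k)).sum = (t.map (fun v : ℕ => (v : ℚ) ^ k)).sum) :
    s = t := by
  have h1 : ∀ q : Polynomial ℚ, (s.map (fun v : ℕ => (v : ℚ) * q.eval (v : ℚ))).sum
      = (t.map (fun v : ℕ => (v : ℚ) * q.eval (v : ℚ))).sum := by
    intro q
    induction q using Polynomial.induction_on' with
    | add p q hp hq => simp only [Polynomial.eval_add, mul_add, Multiset.sum_map_add, hp, hq]
    | monomial n a =>
      have := h (n + 1) (by omega)
      simp only [Polynomial.eval_monomial]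
      have e : ∀ v : ℕ, (v : ℚ) * (a * (v : ℚ) ^ n) = a * (v : ℚ) ^ (n + 1) := fun v => by ring
      simp only [e, Multiset.sum_map_mul_left, this]
  ext v
  rcases Nat.eq_zero_or_pos v with rfl | hv
  · rw [Multiset.count_eq_zero_of_notMem hs, Multiset.count_eq_zero_of_notMem ht]
  let U : Finset ℕ := (s + t).toFinset.erase v
  let q : Polynomial ℚ := ∏ u ∈ U, (Polynomial.X - Polynomial.C (u : ℚ))
  have hq0 : ∀ w ∈ s + t, w ≠ v → q.eval (w : ℚ) = 0 := by
    intro w hw hwv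
    rw [Polynomial.eval_prod]
    exact Finset.prod_eq_zero (i := w) (by simpa [U, hwv] using hw) (by simp)
  have hqv : q.eval (v : ℚ) ≠ 0 := by
    rw [Polynomial.eval_prod, Finset.prod_ne_zero_iff]
    intro u hu
    have : u ≠ v := (Finset.mem_erase.1 hu).1
    simp only [Polynomial.eval_sub, Polynomial.eval_X, Polynomial.eval_C, sub_ne_zero]
    exact_mod_cast this.symm
  have key : ∀ r ≤ s + t, (r.map (fun w : ℕ => (w : ℚ) * q.eval (w : ℚ))).sum
      = r.count v * ((v : ℚ) * q.eval (v : ℚ)) := by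
    intro r
    induction r using Multiset.induction_on with
    | empty => simp
    | cons a r ih =>
      intro hr
      have ha : a ∈ s + t := Multiset.mem_of_le hr (Multiset.mem_cons_self _ _)
      rw [Multiset.map_cons, Multiset.sum_cons, ih ((Multiset.le_cons_self _ _).trans hr),
        Multiset.count_cons]
      by_cases hav : v = a
      · subst hav; simp; ring
      · simp [hav, hq0 a ha (Ne.symm hav)]
  have := h1 q
  rw [key s (Multiset.le_add_right _ _), key t (Multiset.le_add_left _ _)] at this
  have hv' : (v : ℚ) * q.eval (v : ℚ) ≠ 0 := mul_ne_zero (by positivity) hqv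
  exact_mod_cast mul_right_cancel₀ hv' this

open MvPowerSeries (coeff)

/-! ### Exponent multisets of monomials -/

/-- The multiset of the nonzero exponents of a monomial. -/
def exps (d : ℕ →₀ ℕ) : Multiset ℕ := d.support.val.map d

/-- The multiset `{m}`, with zero discarded. -/
def singleNZ (m : ℕ) : Multiset ℕ := if m = 0 then 0 else {m}

@[simp] theorem singleNZ_zero : singleNZ 0 = 0 := rfl

theorem singleNZ_of_ne {m : ℕ} (h : m ≠ 0) : singleNZ m = {m} := if_neg h

@[simp] theorem sum_singleNZ (m : ℕ) : (singleNZ m).sum = m := by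
  unfold singleNZ; split_ifs <;> simp_all

theorem zero_notMem_exps (d : ℕ →₀ ℕ) : 0 ∉ exps d := by
  simp [exps]

theorem exps_eq_sum (d : ℕ →₀ ℕ) : exps d = d.sum fun _ v => singleNZ v := by
  have : ∀ i ∈ d.support, singleNZ (d i) = {d i} := fun i hi =>
    singleNZ_of_ne (Finsupp.mem_support_iff.1 hi)
  rw [Finsupp.sum, Finset.sum_congr rfl this, ← Multiset.sum_map_singleton (exps d), exps,
    Multiset.map_map]
  rfl

theorem exps_eq_add_erase (d : ℕ →₀ ℕ) (i : ℕ) : exps d = singleNZ (d i) + exps (d.erase i) := by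
  rw [exps_eq_sum, exps_eq_sum]
  exact (Finsupp.add_sum_erase' d i (fun _ v => singleNZ v) (fun _ => rfl)).symm

theorem exps_sub_single (d : ℕ →₀ ℕ) (i k : ℕ) (hk : 0 < k) (h : k ≤ d i) :
    exps (d - Finsupp.single i k) = (exps d).erase (d i) + singleNZ (d i - k) := by
  have h1 : (d - Finsupp.single i k).erase i = d.erase i := by
    ext j
    by_cases hj : j = i
    · simp [hj]
    · simp [Finsupp.erase_ne hj, hj]
  rw [exps_eq_add_erase _ i, h1, exps_eq_add_erase d i, singleNZ_of_ne (by omega : d i ≠ 0),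
    Multiset.singleton_add, Multiset.erase_cons_head, Finsupp.tsub_apply, Finsupp.single_eq_same,
    add_comm]

theorem sum_support_eq {M : Type*} [AddCommMonoid M] (d : ℕ →₀ ℕ) (g : ℕ → M) :
    ∑ i ∈ d.support, g (d i) = ((exps d).map g).sum := by
  rw [exps, Multiset.map_map]
  rfl

theorem exps_eq_zero_iff (d : ℕ →₀ ℕ) : exps d = 0 ↔ d = 0 := by
  simp [exps]

/-- The representative avoids `x₀` because moments agree with powers of the Dunkl operator only at
such monomials. -/
theorem exists_exps_eq (t : Multiset ℕ) (ht : 0 ∉ t) : ∃ d : ℕ →₀ ℕ, d 0 = 0 ∧ exps d = t := by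
  induction t using Multiset.induction_on with
  | empty => exact ⟨0, rfl, by simp [exps_eq_zero_iff]⟩
  | cons k t ih =>
    obtain ⟨d, hd, rfl⟩ := ih (fun h => ht (Multiset.mem_cons_of_mem h))
    have hk : k ≠ 0 := fun h => ht (h ▸ Multiset.mem_cons_self _ _)
    obtain ⟨i, hi⟩ := Infinite.exists_notMem_finset (insert 0 d.support)
    simp only [Finset.mem_insert, Finsupp.mem_support_iff, not_or, not_not] at hi
    refine ⟨d + Finsupp.single i k, by simp [hd, hi.1], ?_⟩
    have h1 : (d + Finsupp.single i k).erase i = d := by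
      ext j
      by_cases hj : j = i
      · simp [hj, hi.2]
      · simp [Finsupp.erase_ne hj]
    rw [exps_eq_add_erase _ i, h1]
    simp [hi.2, singleNZ_of_ne hk]

/-! ### Coefficients of symmetric functions -/

theorem coeff_mul_powerSumSeries (f : MvPowerSeries ℕ F) (k : ℕ+) (d : ℕ →₀ ℕ) (S : Finset ℕ)
    (hS : d.support ⊆ S) : coeff d (f * powerSumSeries k) =
      ∑ i ∈ S, if (k : ℕ) ≤ d i then coeff (d - Finsupp.single i (k : ℕ)) f else 0 := by
  classical
  have hinj : ∀ i j : ℕ, Finsupp.single i (k : ℕ) = Finsupp.single j (k : ℕ) → i = j := fun i j h =>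
    Finsupp.single_left_injective k.ne_zero h
  have h1 : ∀ x ∈ Finset.HasAntidiagonal.antidiagonal d, coeff x.1 f * coeff x.2 (powerSumSeries k) =
      ∑ i ∈ S, if x.2 = Finsupp.single i (k : ℕ) then coeff x.1 f else 0 := by
    intro x hx
    have hx' := Finset.HasAntidiagonal.mem_antidiagonal.1 hx
    by_cases h : ∃ i, x.2 = Finsupp.single i (k : ℕ)
    · obtain ⟨i, hi⟩ := h
      have hiS : i ∈ S := hS (by
        rw [Finsupp.mem_support_iff, ← hx', hi]
        simp)
      rw [Finset.sum_eq_single_of_mem i hiS, if_pos hi]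
      · have : coeff x.2 (powerSumSeries k) = 1 := if_pos ⟨i, hi⟩
        rw [this, mul_one]
      · intro j _ hj
        rw [if_neg]
        intro h
        exact hj (hinj _ _ (h.symm.trans hi))
    · have : coeff x.2 (powerSumSeries k) = 0 := if_neg h
      rw [this, mul_zero]
      push Not at h
      exact (Finset.sum_eq_zero fun i _ => if_neg (h i)).symm
  rw [MvPowerSeries.coeff_mul, Finset.sum_congr rfl h1, Finset.sum_comm]
  refine Finset.sum_congr rfl fun i _ => ?_
  split_ifs with hi
  · have hle : Finsupp.single i (k : ℕ) ≤ d := Finsupp.single_le_iff.2 hi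
    rw [Finset.sum_eq_single (d - Finsupp.single i (k : ℕ), Finsupp.single i (k : ℕ)), if_pos rfl]
    · rintro ⟨x, y⟩ hx hxy
      refine if_neg fun h => hxy ?_
      have hx' := Finset.HasAntidiagonal.mem_antidiagonal.1 hx
      simp only at h hx'
      rw [← hx', ← h, add_tsub_cancel_right]
    · intro h
      exact absurd (Finset.HasAntidiagonal.mem_antidiagonal.2 (tsub_add_cancel_of_le hle)) h
  · refine Finset.sum_eq_zero fun x hx => if_neg fun h => hi ?_
    have hx' := Finset.HasAntidiagonal.mem_antidiagonal.1 hx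
    rw [← Finsupp.single_le_iff, ← hx', h]
    exact le_add_self

@[simp] theorem toSeries_p (k : ℕ+) : toSeries (p k) = powerSumSeries k := by
  simp [toSeries]

theorem coeff_toSeries_mul_p (f : SymFun) (k : ℕ+) (d : ℕ →₀ ℕ) :
    coeff d (toSeries (f * p k)) = ∑ i ∈ d.support,
      if (k : ℕ) ≤ d i then coeff (d - Finsupp.single i (k : ℕ)) (toSeries f) else 0 := by
  rw [map_mul, toSeries_p, coeff_mul_powerSumSeries _ _ _ _ subset_rfl]

/-- This is the symmetry of `toSeries f`. In the step for `f * p k`, removing `x_i ^ k` from a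
monomial changes its exponent multiset in a way that depends only on the exponent of `x_i`. -/
theorem exists_coeff_eq (f : SymFun) :
    ∃ φ : Multiset ℕ → F, ∀ d, coeff d (toSeries f) = φ (exps d) := by
  classical
  induction f using MvPolynomial.induction_on with
  | C a =>
    refine ⟨fun s => if s = 0 then a else 0, fun d => ?_⟩
    rw [← MvPolynomial.algebraMap_eq, AlgHom.commutes, MvPowerSeries.algebraMap_apply,
      MvPowerSeries.coeff_C]
    simp [exps_eq_zero_iff]
  | add f g hf hg =>
    obtain ⟨φ, hφ⟩ := hf
    obtain ⟨ψ, hψ⟩ := hg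
    exact ⟨fun s => φ s + ψ s, fun d => by simp [hφ, hψ]⟩
  | mul_X f k hf =>
    obtain ⟨φ, hφ⟩ := hf
    refine ⟨fun s => (s.map fun v =>
      if (k : ℕ) ≤ v then φ (s.erase v + singleNZ (v - k)) else 0).sum, fun d => ?_⟩
    rw [coeff_toSeries_mul_p]
    refine Eq.trans ?_ (sum_support_eq d fun v =>
      if (k : ℕ) ≤ v then φ ((exps d).erase v + singleNZ (v - k)) else 0)
    refine Finset.sum_congr rfl fun i _ => ?_
    split_ifs with h
    · rw [hφ, exps_sub_single d i k k.pos h]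
    · rfl

/-- The coefficient in `f` of the monomials with a given multiset of exponents. -/
noncomputable def mcoeff (f : SymFun) : Multiset ℕ → F := (exists_coeff_eq f).choose

theorem coeff_toSeries (f : SymFun) (d : ℕ →₀ ℕ) : coeff d (toSeries f) = mcoeff f (exps d) :=
  (exists_coeff_eq f).choose_spec d

theorem coeff_monomialSymm {n : ℕ} (μ : n.Partition) (d : ℕ →₀ ℕ) [Decidable (exps d = μ.parts)] :
    coeff d (monomialSymm μ) = if exps d = μ.parts then 1 else 0 := by
  change (if d.support.val.map d = μ.parts then 1 else 0) = _
  congr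

theorem zero_notMem_parts {n : ℕ} (μ : n.Partition) : 0 ∉ μ.parts := fun h =>
  absurd (μ.parts_pos h) (lt_irrefl 0)

theorem toSeries_eq_sum {n : ℕ} (f : SymFun)
    (hf : ∀ d, coeff d (toSeries f) ≠ 0 → (exps d).sum = n) :
    toSeries f = ∑ μ : n.Partition, mcoeff f μ.parts • monomialSymm μ := by
  classical
  ext d
  rw [map_sum, coeff_toSeries]
  simp only [map_smul, coeff_monomialSymm, smul_eq_mul, mul_ite, mul_one, mul_zero]
  by_cases hd : (exps d).sum = n
  · let μ₀ : n.Partition := ⟨exps d, fun {i} hi => Nat.pos_of_ne_zero fun h =>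
      zero_notMem_exps d (h ▸ hi), hd⟩
    rw [Finset.sum_eq_single_of_mem μ₀ (Finset.mem_univ _)]
    · simp [μ₀]
    · intro μ _ hμ
      rw [if_neg]
      exact fun h => hμ (Nat.Partition.ext h.symm)
  · rw [Finset.sum_eq_zero]
    · by_contra h
      exact hd (hf d (by rwa [coeff_toSeries]))
    · intro μ _
      rw [if_neg]
      exact fun h => hd (h ▸ μ.parts_sum)

/-! ### Power-sum products against monomial symmetric functions -/

/-- The product of the power sums `p_k`, for `k` in the multiset `s`. -/
noncomputable def powerProd (s : Multiset ℕ+) : SymFun := (s.map p).prod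

/-- Each factor `p_k` adds `k` to the exponent of one variable, so there are at most as many
exponents as factors, and equally many only when all factors hit different variables. -/
theorem coeff_powerProd_ne_zero (s : Multiset ℕ+) (d : ℕ →₀ ℕ)
    (h : coeff d (toSeries (powerProd s)) ≠ 0) :
    (exps d).card ≤ s.card ∧ ((exps d).card = s.card → exps d = s.map (↑)) ∧
      (exps d).sum = (s.map ((↑) : ℕ+ → ℕ)).sum := by
  classical
  induction s using Multiset.induction_on generalizing d with
  | empty =>
    have : d = 0 := by
      by_contra hd
      simp [powerProd, MvPowerSeries.coeff_one, hd] at h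
    subst this
    simp [exps]
  | cons k s ih =>
    rw [show powerProd (k ::ₘ s) = powerProd s * p k by simp [powerProd, mul_comm],
      coeff_toSeries_mul_p] at h
    obtain ⟨i, hi, hi'⟩ := Finset.exists_ne_zero_of_sum_ne_zero h
    have hk : (k : ℕ) ≤ d i := by
      by_contra hk
      simp [hk] at hi'
    rw [if_pos hk] at hi'
    obtain ⟨h1, h2, h3⟩ := ih _ hi'
    rw [exps_sub_single d i k k.pos hk] at h1 h2 h3
    have hmem : d i ∈ exps d := Multiset.mem_map_of_mem d hi
    obtain ⟨t, ht⟩ := Multiset.exists_cons_of_mem hmem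
    rw [ht, Multiset.erase_cons_head] at h1 h2 h3
    rw [ht]
    simp only [Multiset.card_cons, Multiset.sum_cons, Multiset.map_cons, Multiset.card_add,
      Multiset.sum_add, sum_singleNZ] at *
    refine ⟨by omega, fun hc => ?_, by omega⟩
    have hd : d i = k := by
      by_contra hne
      rw [singleNZ_of_ne (by omega), Multiset.card_singleton] at h1
      omega
    rw [hd] at h2 ⊢
    simp only [tsub_self, singleNZ_zero, add_zero, Multiset.card_zero] at h2
    rw [h2 (by omega)]

theorem exists_coeff_powerProd (s : Multiset ℕ+) :
    ∃ c : ℕ, c ≠ 0 ∧ ∀ d, exps d = s.map (↑) → coeff d (toSeries (powerProd s)) = c := by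
  classical
  induction s using Multiset.induction_on with
  | empty =>
    refine ⟨1, one_ne_zero, fun d hd => ?_⟩
    have : d = 0 := by simpa [exps_eq_zero_iff] using hd
    subst this
    simp [powerProd]
  | cons k s ih =>
    obtain ⟨c, hc, h⟩ := ih
    -- The last factor `p_k` must hit a variable of exponent exactly `k`: otherwise one more
    -- exponent would remain than there are other factors.
    refine ⟨(((k ::ₘ s).map ((↑) : ℕ+ → ℕ)).map fun v : ℕ => if v = k then c else 0).sum,
      by simp [hc], fun d hd => ?_⟩
    rw [show powerProd (k ::ₘ s) = powerProd s * p k by simp [powerProd, mul_comm],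
      coeff_toSeries_mul_p, ← hd, ← sum_support_eq, Nat.cast_sum]
    refine Finset.sum_congr rfl fun i hi => ?_
    split_ifs with h1 h2 h2
    · refine h _ ?_
      rw [exps_sub_single d i k k.pos h1, h2, hd]
      simp
    · by_contra hne
      have h3 := (coeff_powerProd_ne_zero _ _ hne).1
      rw [exps_sub_single d i k k.pos h1, singleNZ_of_ne (by omega), Multiset.card_add,
        Multiset.card_erase_of_mem (show d i ∈ exps d from Multiset.mem_map_of_mem d hi), hd] at h3
      simp at h3
    · omega
    · simp

theorem monomial_eq_powerProd (e : ℕ+ →₀ ℕ) (a : F) :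
    MvPolynomial.monomial e a = a • powerProd e.toMultiset := by
  rw [MvPolynomial.monomial_eq, MvPolynomial.smul_eq_C_mul, powerProd]
  congr 1
  induction e using Finsupp.induction_linear with
  | zero => simp
  | add f g hf hg =>
    rw [Finsupp.prod_add_index' (by simp) (by simp [pow_add]), hf, hg, map_add, Multiset.map_add,
      Multiset.prod_add]
  | single i n => simp [Multiset.map_nsmul, Multiset.prod_nsmul]

/-- Algebraic independence of the power sums. Among the products occurring in `f`, take one with the
most factors; no other product occurring in `f` reaches the monomial with these factors as
exponents. -/
theorem toSeries_injective : Function.Injective toSeries := by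
  rw [injective_iff_map_eq_zero]
  intro f hf
  by_contra hne
  obtain ⟨e, he, hmax⟩ := Finset.exists_max_image f.support (fun e => e.toMultiset.card)
    (MvPolynomial.support_nonempty.2 hne)
  obtain ⟨d, -, hd⟩ := exists_exps_eq (e.toMultiset.map ((↑) : ℕ+ → ℕ)) (by simp)
  obtain ⟨c, hc, h⟩ := exists_coeff_powerProd e.toMultiset
  have h1 : coeff d (toSeries f) = f.coeff e * c := by
    conv_lhs => rw [f.as_sum]
    simp only [monomial_eq_powerProd, map_sum, map_smul, smul_eq_mul]
    rw [Finset.sum_eq_single_of_mem e he, h d hd]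
    intro e' he' hee
    by_contra h0
    obtain ⟨h2, h3, -⟩ := coeff_powerProd_ne_zero _ _ (right_ne_zero_of_mul h0)
    have h4 := hmax e' he'
    rw [hd, Multiset.card_map] at h2 h3
    have h5 := h3 (le_antisymm h2 h4)
    have h6 := Multiset.map_injective PNat.coe_injective h5
    refine hee (Finsupp.ext fun x => ?_)
    rw [← Finsupp.count_toMultiset, ← Finsupp.count_toMultiset, h6]
  rw [hf, map_zero] at h1
  rw [MvPolynomial.mem_support_iff] at he
  exact mul_ne_zero he (Nat.cast_ne_zero.2 hc) h1.symm

/-- The power-sum product of `μ` is a nonzero integer multiple of `m_μ` plus monomial functions with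
fewer parts, so induction on the number of parts applies. -/
theorem exists_toSeries_eq_monomialSymm {n : ℕ} (μ : n.Partition) :
    ∃ f : SymFun, toSeries f = monomialSymm μ := by
  classical
  induction hm : μ.parts.card using Nat.strong_induction_on generalizing μ with
  | _ m ih =>
    obtain ⟨s, hs⟩ : ∃ s : Multiset ℕ+, s.map ((↑) : ℕ+ → ℕ) = μ.parts :=
      CanLift.prf (β := Multiset ℕ+) μ.parts fun x hx => μ.parts_pos hx
    obtain ⟨c, hc, h⟩ := exists_coeff_powerProd s
    have hexp := toSeries_eq_sum (n := n) (powerProd s) fun d hd => by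
      rw [(coeff_powerProd_ne_zero _ _ hd).2.2, hs, μ.parts_sum]
    have hμ : mcoeff (powerProd s) μ.parts = c := by
      obtain ⟨d, -, hd⟩ := exists_exps_eq μ.parts (zero_notMem_parts μ)
      rw [← hd, ← coeff_toSeries, h d (hd.trans hs.symm)]
    rw [← Finset.add_sum_erase _ _ (Finset.mem_univ μ), hμ] at hexp
    have hrest : ∃ g : SymFun, toSeries g = ∑ ν ∈ Finset.univ.erase μ,
        mcoeff (powerProd s) ν.parts • monomialSymm ν := by
      have : ∀ ν : n.Partition, ∃ g : SymFun, ν ∈ Finset.univ.erase μ →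
          toSeries g = mcoeff (powerProd s) ν.parts • monomialSymm ν := by
        intro ν
        by_cases h0 : mcoeff (powerProd s) ν.parts = 0
        · exact ⟨0, fun _ => by simp [h0]⟩
        by_cases hν : ν = μ
        · exact ⟨0, fun h => absurd hν (Finset.ne_of_mem_erase h)⟩
        obtain ⟨d, -, hd⟩ := exists_exps_eq ν.parts (zero_notMem_parts ν)
        rw [← hd, ← coeff_toSeries] at h0
        obtain ⟨h1, h2, -⟩ := coeff_powerProd_ne_zero _ _ h0
        rw [hd, hs] at h2
        rw [hd, ← Multiset.card_map ((↑) : ℕ+ → ℕ) s, hs] at h1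
        have h3 : ν.parts.card < m := by
          rw [← hm]
          refine lt_of_le_of_ne h1 fun h => hν (Nat.Partition.ext (h2 ?_))
          rw [h, ← hs, Multiset.card_map]
        obtain ⟨g, hg⟩ := ih _ h3 ν rfl
        exact ⟨mcoeff (powerProd s) ν.parts • g, fun _ => by rw [map_smul, hg]⟩
      choose g hg using this
      exact ⟨∑ ν ∈ Finset.univ.erase μ, g ν, by rw [map_sum]; exact Finset.sum_congr rfl hg⟩
    obtain ⟨g, hg⟩ := hrest
    refine ⟨(c : F)⁻¹ • (powerProd s - g), ?_⟩
    rw [map_smul, map_sub, hg, hexp, add_sub_cancel_right, smul_smul,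
      inv_mul_cancel₀ (Nat.cast_ne_zero.2 hc), one_smul]

theorem isUnitriangular_iff {n : ℕ} (lam : n.Partition) (f : SymFun) :
    IsUnitriangular lam f ↔ (∀ d, coeff d (toSeries f) ≠ 0 → Dom (exps d) lam.parts) ∧
      ∀ d, exps d = lam.parts → coeff d (toSeries f) = 1 := by
  classical
  constructor
  · rintro ⟨c, hc, hf⟩
    have hcoeff : ∀ d, coeff d (toSeries f) =
        ∑ μ : n.Partition with DomLE μ lam, if exps d = μ.parts then c μ else 0 := by
      intro d
      rw [hf, map_sum]
      refine Finset.sum_congr (by congr) fun μ _ => ?_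
      rw [map_smul, coeff_monomialSymm, smul_eq_mul, mul_ite, mul_one, mul_zero]
    refine ⟨fun d hd => ?_, fun d hd => ?_⟩
    · rw [hcoeff] at hd
      obtain ⟨μ, hμ, h⟩ := Finset.exists_ne_zero_of_sum_ne_zero hd
      have : exps d = μ.parts := by
        by_contra h'
        simp [h'] at h
      rw [this, ← domLE_iff]
      exact (Finset.mem_filter.1 hμ).2
    · rw [hcoeff, Finset.sum_eq_single lam, if_pos hd, hc]
      · intro μ _ hμ
        rw [if_neg]
        intro h
        exact hμ (Nat.Partition.ext (h.symm.trans hd))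
      · intro h
        rw [Finset.mem_filter] at h
        exact absurd ⟨Finset.mem_univ _, (domLE_iff _ _).2 (Dom.refl _)⟩ h
  · rintro ⟨h1, h2⟩
    refine ⟨fun μ => mcoeff f μ.parts, ?_, ?_⟩
    · obtain ⟨d, -, hd⟩ := exists_exps_eq lam.parts (zero_notMem_parts lam)
      change mcoeff f lam.parts = 1
      rw [← hd, ← coeff_toSeries, h2 d hd]
    · rw [toSeries_eq_sum (n := n) f fun d hd => (h1 d hd).1.trans lam.parts_sum]
      refine (Finset.sum_filter_of_ne fun μ _ h => ?_).symm
      obtain ⟨d, -, hd⟩ := exists_exps_eq μ.parts (zero_notMem_parts μ)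
      rw [domLE_iff, ← hd]
      refine h1 d fun h0 => h ?_
      rw [← hd, ← coeff_toSeries, h0, zero_smul]

/-! ### The scalar product -/

theorem zee_pos (d : ℕ+ →₀ ℕ) : 0 < zee d :=
  Finset.prod_pos fun i _ => Nat.mul_pos (pow_pos i.pos _) (Nat.factorial_pos _)

theorem jackInner_eq_sum (f g : SymFun) (S : Finset (ℕ+ →₀ ℕ)) (hS : f.support ⊆ S) :
    jackInner f g = ∑ d ∈ S, f.coeff d * g.coeff d * (α ^ d.degree * (zee d : F)) := by
  refine Finset.sum_subset hS fun d _ hd => ?_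
  rw [MvPolynomial.notMem_support_iff.1 hd, zero_mul, zero_mul]

/-- The Jack scalar product as a bilinear form. -/
noncomputable def jackForm : SymFun →ₗ[F] SymFun →ₗ[F] F :=
  LinearMap.mk₂ F jackInner
    (fun f f' g => by
      classical
      rw [jackInner_eq_sum (f + f') g (f.support ∪ f'.support) MvPolynomial.support_add,
        jackInner_eq_sum f g _ Finset.subset_union_left,
        jackInner_eq_sum f' g _ Finset.subset_union_right, ← Finset.sum_add_distrib]
      exact Finset.sum_congr rfl fun d _ => by rw [MvPolynomial.coeff_add]; ring)
    (fun c f g => by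
      rw [jackInner_eq_sum (c • f) g f.support MvPolynomial.support_smul, jackInner, smul_eq_mul,
        Finset.mul_sum]
      exact Finset.sum_congr rfl fun d _ => by rw [MvPolynomial.coeff_smul, smul_eq_mul]; ring)
    (fun f g g' => by
      simp only [jackInner, ← Finset.sum_add_distrib]
      exact Finset.sum_congr rfl fun d _ => by rw [MvPolynomial.coeff_add]; ring)
    (fun c f g => by
      rw [jackInner, jackInner, smul_eq_mul, Finset.mul_sum]
      exact Finset.sum_congr rfl fun d _ => by rw [MvPolynomial.coeff_smul, smul_eq_mul]; ring)

@[simp] theorem jackForm_apply (f g : SymFun) : jackForm f g = jackInner f g := rfl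

theorem jackForm_symm (f g : SymFun) : jackForm f g = jackForm g f := by
  classical
  rw [jackForm_apply, jackForm_apply, jackInner_eq_sum f g _ (Finset.subset_union_left (s₂ := g.support)),
    jackInner_eq_sum g f _ (Finset.subset_union_right (s₁ := f.support))]
  exact Finset.sum_congr rfl fun d _ => by ring

theorem jackForm_monomial (d e : ℕ+ →₀ ℕ) (a b : F) :
    jackForm (MvPolynomial.monomial d a) (MvPolynomial.monomial e b) =
      if e = d then a * b * (α ^ d.degree * (zee d : F)) else 0 := by
  classical
  rw [jackForm_apply, jackInner_eq_sum _ _ {d} MvPolynomial.support_monomial_subset,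
    Finset.sum_singleton, MvPolynomial.coeff_monomial, MvPolynomial.coeff_monomial, if_pos rfl]
  split_ifs <;> simp

theorem zee_add_single (d : ℕ+ →₀ ℕ) (k : ℕ+) :
    zee (d + Finsupp.single k 1) = zee d * (k * (d k + 1)) := by
  have h : ∀ e : ℕ+ →₀ ℕ, zee e = ((k : ℕ) ^ e k * (e k).factorial) * zee (e.erase k) := fun e =>
    (Finsupp.mul_prod_erase' e k (fun (i : ℕ+) m => (i : ℕ) ^ m * m.factorial) (by simp)).symm
  have h1 : (d + Finsupp.single k 1).erase k = d.erase k := by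
    rw [Finsupp.erase_add]; simp
  rw [h, h d, h1]
  simp only [Finsupp.add_apply, Finsupp.single_eq_same, pow_succ, Nat.factorial_succ]
  ring

/-- On monomials the adjunction is the identity `z_{d + e_k} = z_d · k (d_k + 1)` together with one
extra factor `α`. -/
theorem jackForm_p_mul (k : ℕ+) (f g : SymFun) :
    jackForm (f * p k) g = jackForm f ((α * (k : ℕ)) • dp k g) := by
  induction f using MvPolynomial.induction_on' with
  | add f f' hf hf' => rw [add_mul, map_add, LinearMap.add_apply, hf, hf', map_add, LinearMap.add_apply]
  | monomial d a =>
    induction g using MvPolynomial.induction_on' with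
    | add g g' hg hg' => rw [map_add, hg, hg', show dp k (g + g') = dp k g + dp k g' from map_add _ _ _, smul_add,
        map_add]
    | monomial e b =>
      rw [show (MvPolynomial.monomial d a * p k : SymFun)
        = MvPolynomial.monomial (d + Finsupp.single k 1) a by
          rw [p, MvPolynomial.X, MvPolynomial.monomial_mul, mul_one], dp,
        MvPolynomial.pderiv_monomial, map_smul, jackForm_monomial, jackForm_monomial]
      by_cases h : e = d + Finsupp.single k 1
      · subst h
        rw [if_pos rfl, if_pos (by simp), zee_add_single, map_add]
        simp [pow_succ]
        ring
      · rw [if_neg h]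
        split_ifs with h'
        · have hk : e k = 0 := by
            by_contra hk
            refine h ?_
            rw [← h', tsub_add_cancel_of_le]
            rw [Finsupp.single_le_iff]
            omega
          simp [hk]
        · simp

/-- After clearing denominators, `⟨f, f⟩ = 0` becomes a vanishing sum of squares with weights `α ^ l
z`. At every positive rational value of `α` the weights are positive, so each square vanishes there,
and hence identically. -/
theorem jackForm_anisotropic (f : SymFun) (h : jackForm f f = 0) : f = 0 := by
  classical
  obtain ⟨b, hb⟩ := IsLocalization.exist_integer_multiples_of_finset
    (nonZeroDivisors (Polynomial ℚ)) (f.support.image f.coeff)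
  have hb0 : algebraMap (Polynomial ℚ) F b ≠ 0 :=
    IsFractionRing.to_map_ne_zero_of_mem_nonZeroDivisors b.2
  have hq : ∀ d, ∃ q : Polynomial ℚ, algebraMap _ F q = algebraMap _ F b.1 * f.coeff d := by
    intro d
    by_cases hd : d ∈ f.support
    · obtain ⟨q, hq⟩ := hb _ (Finset.mem_image_of_mem _ hd)
      exact ⟨q, by rw [hq, Algebra.smul_def]⟩
    · exact ⟨0, by rw [MvPolynomial.notMem_support_iff.1 hd]; simp⟩
  choose q hq using hq
  have hsum : ∑ d ∈ f.support, q d ^ 2 * (Polynomial.X ^ d.degree * (zee d : Polynomial ℚ)) = 0 := by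
    apply RatFunc.algebraMap_injective (K := ℚ)
    rw [map_zero, ← mul_zero (algebraMap _ F b.1 ^ 2), ← h, jackForm_apply, jackInner,
      Finset.mul_sum, map_sum]
    refine Finset.sum_congr rfl fun d _ => ?_
    simp only [map_mul, map_pow, map_natCast, hq, RatFunc.algebraMap_X, α]
    ring
  have hq0 : ∀ d ∈ f.support, q d = 0 := by
    intro d hd
    refine Polynomial.eq_zero_of_infinite_isRoot _ ((Set.Ioi_infinite (0 : ℚ)).mono fun x hx => ?_)
    have hx' : (0 : ℚ) < x := hx
    have h1 := congrArg (Polynomial.eval x) hsum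
    simp only [Polynomial.eval_finsetSum, Polynomial.eval_mul, Polynomial.eval_pow,
      Polynomial.eval_X, Polynomial.eval_natCast, Polynomial.eval_zero] at h1
    rw [Finset.sum_eq_zero_iff_of_nonneg (fun _ _ => by positivity)] at h1
    have h2 := h1 d hd
    have h3 : x ^ d.degree * (zee d : ℚ) ≠ 0 := by
      have := zee_pos d
      positivity
    simpa [h3] using h2
  by_contra hf
  obtain ⟨d, hd⟩ := MvPolynomial.support_nonempty.2 hf
  have := hq d
  rw [hq0 d hd, map_zero] at this
  exact mul_ne_zero hb0 (MvPolynomial.mem_support_iff.1 hd) this.symm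

/-! ### The Lax operator -/

/-- The derivation `f ↦ ∑ₙ α n wⁿ ∂f/∂pₙ` with values in `Λ_F[w]`. -/
noncomputable def powerDer : Derivation F SymFun (Polynomial SymFun) :=
  MvPolynomial.mkDerivation F fun n : ℕ+ =>
    Polynomial.monomial (n : ℕ) (MvPolynomial.C (α * (n : ℕ)) : SymFun)

theorem coeff_powerDer (f : SymFun) (n : ℕ+) :
    (powerDer f).coeff n = (α * (n : ℕ)) • dp n f := by
  have h : (Polynomial.lcoeff SymFun (n : ℕ)).compDer powerDer =
      (α * (n : ℕ)) • (MvPolynomial.pderiv n : Derivation F SymFun SymFun) := by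
    refine MvPolynomial.derivation_ext fun i => ?_
    change (powerDer (MvPolynomial.X i)).coeff n = (α * (n : ℕ)) • MvPolynomial.pderiv n (MvPolynomial.X i)
    simp only [powerDer, MvPolynomial.mkDerivation_X,
      MvPolynomial.pderiv_X, Polynomial.coeff_monomial, PNat.coe_inj]
    by_cases hi : i = n
    · subst hi
      simp [MvPolynomial.smul_eq_C_mul]
    · simp [hi]
  exact congrArg (fun d => d f) h

theorem coeff_zero_powerDer (f : SymFun) : (powerDer f).coeff 0 = 0 := by
  have h : (Polynomial.lcoeff SymFun 0).compDer powerDer = 0 := by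
    refine MvPolynomial.derivation_ext fun i => ?_
    change (powerDer (MvPolynomial.X i)).coeff 0 = 0
    simp [powerDer, MvPolynomial.mkDerivation_X, Polynomial.coeff_monomial]
  exact congrArg (fun d => d f) h

theorem powerDer_eq_sum (f : SymFun) (S : Finset ℕ+) (hS : ∀ n ∉ S, dp n f = 0) :
    powerDer f = ∑ n ∈ S, Polynomial.monomial (n : ℕ) ((α * (n : ℕ)) • dp n f) := by
  ext1 m
  rw [Polynomial.finsetSum_coeff]
  simp only [Polynomial.coeff_monomial]
  rcases Nat.eq_zero_or_pos m with rfl | hm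
  · simp [coeff_zero_powerDer]
  · lift m to ℕ+ using hm
    rw [coeff_powerDer]
    simp only [PNat.coe_inj]
    rw [Finset.sum_ite_eq']
    split_ifs with h
    · rfl
    · rw [hS m h, smul_zero]

/-- The operator on `Λ_F[w]` that sends `w ^ a g` to
`(α - 1) a w ^ a g + ∑ₙ α n w ^ (a + n) ∂g/∂pₙ + ∑_{1 ≤ n ≤ a} w ^ (a - n) pₙ g`. -/
noncomputable def lax : Module.End F (Polynomial SymFun) :=
  Polynomial.lsum fun a =>
    ((α - 1) * a) • (Polynomial.monomial a : SymFun →ₗ[SymFun] _).restrictScalars F +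
      LinearMap.mulLeft F (Polynomial.X ^ a) ∘ₗ (powerDer : SymFun →ₗ[F] Polynomial SymFun) +
      ∑ k ∈ Finset.range a, (Polynomial.monomial (a - (k + 1)) : SymFun →ₗ[SymFun] _).restrictScalars F
        ∘ₗ LinearMap.mulRight F (p k.succPNat)

theorem lax_monomial (a : ℕ) (f : SymFun) :
    lax (Polynomial.monomial a f) = Polynomial.monomial a (((α - 1) * a) • f) +
      Polynomial.X ^ a * powerDer f +
      ∑ k ∈ Finset.range a, Polynomial.monomial (a - (k + 1)) (f * p k.succPNat) := by
  rw [lax, Polynomial.lsum_apply, Polynomial.sum_monomial_index _ _ (by simp)]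
  rw [LinearMap.add_apply, LinearMap.add_apply, LinearMap.sum_apply, LinearMap.smul_apply,
    ← Polynomial.smul_monomial]
  rfl

theorem coeff_lax_self (a : ℕ) (f : SymFun) :
    (lax (Polynomial.monomial a f)).coeff a = ((α - 1) * a) • f := by
  rw [lax_monomial, Polynomial.coeff_add, Polynomial.coeff_add, Polynomial.coeff_monomial,
    if_pos rfl, Polynomial.finsetSum_coeff, Finset.sum_eq_zero, add_zero]
  · have := Polynomial.coeff_X_pow_mul (powerDer f) a 0
    rw [zero_add] at this
    rw [this, coeff_zero_powerDer, add_zero]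
  · intro k hk
    rw [Polynomial.coeff_monomial, if_neg]
    have := Finset.mem_range.1 hk
    omega

theorem coeff_lax_add (a : ℕ) (n : ℕ+) (f : SymFun) :
    (lax (Polynomial.monomial a f)).coeff (a + n) = (α * (n : ℕ)) • dp n f := by
  have hn := n.pos
  rw [lax_monomial, Polynomial.coeff_add, Polynomial.coeff_add, Polynomial.coeff_monomial,
    if_neg (by omega), Polynomial.finsetSum_coeff, Finset.sum_eq_zero, add_zero, zero_add,
    add_comm a, Polynomial.coeff_X_pow_mul, coeff_powerDer]
  intro k _
  rw [Polynomial.coeff_monomial, if_neg]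
  omega

theorem coeff_lax_sub (b : ℕ) (n : ℕ+) (f : SymFun) :
    (lax (Polynomial.monomial (b + n) f)).coeff b = f * p n := by
  have hn := n.pos
  rw [lax_monomial, Polynomial.coeff_add, Polynomial.coeff_add, Polynomial.coeff_monomial,
    if_neg (by omega), Polynomial.finsetSum_coeff, zero_add, Polynomial.coeff_X_pow_mul',
    if_neg (by omega), zero_add, Finset.sum_eq_single n.natPred]
  · rw [Polynomial.coeff_monomial, if_pos, PNat.succPNat_natPred]
    have := PNat.natPred_add_one n
    omega
  · intro k hk hkn
    rw [Polynomial.coeff_monomial, if_neg]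
    have := Finset.mem_range.1 hk
    have := PNat.natPred_add_one n
    omega
  · intro h
    have := PNat.natPred_add_one n
    rw [Finset.mem_range] at h
    omega

/-- The extension of the scalar product to `Λ_F[w]` for which the powers of `w` are orthonormal. -/
noncomputable def polyForm : Polynomial SymFun →ₗ[F] Polynomial SymFun →ₗ[F] F :=
  Polynomial.lsum fun b => jackForm.compl₂ ((Polynomial.lcoeff SymFun b).restrictScalars F)

theorem polyForm_monomial_left (a : ℕ) (f : SymFun) (H : Polynomial SymFun) :
    polyForm (Polynomial.monomial a f) H = jackForm f (H.coeff a) := by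
  rw [polyForm, Polynomial.lsum_apply, Polynomial.sum_monomial_index _ _ (by simp)]
  rfl

theorem polyForm_monomial_right (G : Polynomial SymFun) (b : ℕ) (g : SymFun) :
    polyForm G (Polynomial.monomial b g) = jackForm (G.coeff b) g := by
  induction G using Polynomial.induction_on' with
  | add G G' h h' => simp [h, h']
  | monomial a f =>
    rw [polyForm_monomial_left, Polynomial.coeff_monomial, Polynomial.coeff_monomial]
    by_cases h : a = b
    · rw [if_pos h, if_pos h.symm]
    · rw [if_neg h, if_neg (Ne.symm h), map_zero, map_zero, LinearMap.zero_apply]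

/-- As a matrix indexed by powers of `w`, `lax` has scalars on the diagonal, the derivatives `α n
∂/∂p_n` on one side of it and the adjoint multiplications by `p_n` on the other. -/
theorem polyForm_lax (G H : Polynomial SymFun) : polyForm (lax G) H = polyForm G (lax H) := by
  induction G using Polynomial.induction_on' with
  | add G G' h h' => simp only [map_add, LinearMap.add_apply, h, h']
  | monomial a f =>
    induction H using Polynomial.induction_on' with
    | add H H' h h' => simp only [map_add, h, h']
    | monomial b g =>
      rw [polyForm_monomial_left, polyForm_monomial_right]
      rcases lt_trichotomy a b with h | rfl | h
      · obtain ⟨n, hn⟩ : ∃ n : ℕ+, (n : ℕ) = b - a := ⟨⟨b - a, by omega⟩, rfl⟩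
        obtain rfl : b = a + n := by omega
        rw [coeff_lax_add, coeff_lax_sub, jackForm_symm f, jackForm_p_mul, jackForm_symm g]
      · rw [coeff_lax_self, coeff_lax_self, map_smul, map_smul, LinearMap.smul_apply]
      · obtain ⟨n, hn⟩ : ∃ n : ℕ+, (n : ℕ) = a - b := ⟨⟨a - b, by omega⟩, rfl⟩
        obtain rfl : a = b + n := by omega
        rw [coeff_lax_add, coeff_lax_sub, jackForm_p_mul]

theorem polyForm_lax_pow (k : ℕ) (G H : Polynomial SymFun) :
    polyForm ((lax ^ k) G) H = polyForm G ((lax ^ k) H) := by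
  induction k generalizing G H with
  | zero => rfl
  | succ k ih =>
    rw [pow_succ, Module.End.mul_apply, ih, polyForm_lax, ← Module.End.mul_apply, ← pow_succ',
      ← pow_succ]

/-- The vacuum expectation of the `k`-th power of the operator `lax`. -/
noncomputable def moment (k : ℕ) : Module.End F SymFun :=
  (Polynomial.lcoeff SymFun 0).restrictScalars F ∘ₗ (lax ^ k) ∘ₗ
    (Polynomial.monomial 0 : SymFun →ₗ[SymFun] _).restrictScalars F

theorem moment_apply (k : ℕ) (f : SymFun) :
    moment k f = ((lax ^ k) (Polynomial.monomial 0 f)).coeff 0 := rfl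

theorem jackForm_moment (k : ℕ) (f g : SymFun) :
    jackForm (moment k f) g = jackForm f (moment k g) := by
  rw [moment_apply, moment_apply, ← polyForm_monomial_right, ← polyForm_monomial_left,
    polyForm_lax_pow]

/-! ### The operator `D` as a moment -/

theorem coeff_zero_lax_monomial (n : ℕ+) (f : SymFun) :
    (lax (Polynomial.monomial (n : ℕ) f)).coeff 0 = f * p n := by
  simpa using coeff_lax_sub 0 n f

theorem dp_eq_zero_of_notMem (f : SymFun) (n : ℕ+) (h : n ∉ f.vars) : dp n f = 0 :=
  MvPolynomial.pderiv_eq_zero_of_notMem_vars h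

theorem finsum_splitTerm (f : SymFun) : ∑ᶠ ij, splitTerm f ij =
    ∑ n ∈ f.vars, ∑ k ∈ Finset.range (n - 1),
      splitTerm f (((n : ℕ) - (k + 2)).succPNat, k.succPNat) := by
  classical
  rw [Finset.sum_sigma']
  -- The pair `(i, j)` with `i + j = n` is indexed by `n` and `k = j - 1`, so that `i = n - 1 - k`.
  let e : (Σ _ : ℕ+, ℕ) → ℕ+ × ℕ+ := fun x => (((x.1 : ℕ) - (x.2 + 2)).succPNat, x.2.succPNat)
  set T := f.vars.sigma fun n => Finset.range ((n : ℕ) - 1)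
  have hadd : ∀ x ∈ T, (e x).1 + (e x).2 = x.1 := by
    intro x hx
    have := Finset.mem_range.1 (Finset.mem_sigma.1 hx).2
    rw [← PNat.coe_inj, PNat.add_coe]
    simp only [e, Nat.succPNat_coe]
    omega
  have hinj : Set.InjOn e T := by
    rintro ⟨n, k⟩ hx ⟨m, l⟩ hy h
    have h1 := hadd _ hx
    rw [h, hadd _ hy] at h1
    have h2 : k = l := Nat.succPNat_injective (congrArg Prod.snd h)
    simp only at h1
    rw [h1, h2]
  rw [finsum_eq_sum_of_support_subset (s := T.image e), Finset.sum_image hinj]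
  intro ij hij
  rw [Function.mem_support] at hij
  have hmem : ij.1 + ij.2 ∈ f.vars := by
    by_contra h
    exact hij (by rw [splitTerm, dp_eq_zero_of_notMem _ _ h, mul_zero, smul_zero])
  rw [Finset.coe_image]
  have h1 := PNat.natPred_add_one ij.1
  have h2 := PNat.natPred_add_one ij.2
  refine ⟨⟨ij.1 + ij.2, ij.2.natPred⟩, Finset.mem_sigma.2 ⟨hmem, Finset.mem_range.2 ?_⟩, ?_⟩
  · simp only [PNat.add_coe]
    omega
  · refine Prod.ext (PNat.coe_injective ?_) (PNat.succPNat_natPred _)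
    simp only [e, Nat.succPNat_coe, PNat.add_coe]
    omega

theorem finsum_joinTerm (f : SymFun) : ∑ᶠ ij, joinTerm f ij =
    ∑ i ∈ f.vars, ∑ j ∈ f.vars, joinTerm f (i, j) := by
  rw [← Finset.sum_product']
  refine finsum_eq_sum_of_support_subset _ fun ij hij => ?_
  rw [Finset.coe_product]
  refine ⟨?_, ?_⟩
  · by_contra hv
    exact hij (by rw [joinTerm, dp_comm, dp_eq_zero_of_notMem f _ hv]; simp)
  · by_contra hv
    exact hij (by rw [joinTerm, dp_eq_zero_of_notMem f _ hv]; simp)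

theorem finsum_diagTerm (f : SymFun) : ∑ᶠ k, diagTerm f k = ∑ k ∈ f.vars, diagTerm f k := by
  refine finsum_eq_sum_of_support_subset _ fun k hk => ?_
  by_contra hv
  exact hk (by rw [diagTerm, dp_eq_zero_of_notMem f _ hv]; simp)

/-- From `w ^ i` the first of the two applications lowers, raises or keeps the exponent, and the
second must return to `w ^ 0`. The three cases produce the splitting, joining and diagonal terms of
`D`. -/
theorem coeff_zero_lax_lax (f : SymFun) (i : ℕ+) :
    (lax (lax (Polynomial.monomial (i : ℕ) ((α * (i : ℕ)) • dp i f)))).coeff 0 =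
      (∑ k ∈ Finset.range (i - 1), splitTerm f (((i : ℕ) - (k + 2)).succPNat, k.succPNat)) +
      (∑ j ∈ f.vars, joinTerm f (i, j)) + (α * (α - 1)) • diagTerm f i := by
  have hder : powerDer ((α * (i : ℕ)) • dp i f) = ∑ n ∈ f.vars, Polynomial.monomial (n : ℕ)
      ((α * (n : ℕ)) • dp n ((α * (i : ℕ)) • dp i f)) :=
    powerDer_eq_sum _ _ fun n hn => by
      rw [show dp n ((α * (i : ℕ)) • dp i f) = (α * (i : ℕ)) • dp n (dp i f) from Derivation.map_smul _ _ _,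
        dp_comm, dp_eq_zero_of_notMem f n hn]
      simp
  obtain ⟨m, hm⟩ : ∃ m, (i : ℕ) = m + 1 := ⟨i.natPred, (PNat.natPred_add_one i).symm⟩
  rw [lax_monomial, hder, Finset.mul_sum, map_add, map_add, map_sum, map_sum, Polynomial.coeff_add,
    Polynomial.coeff_add, Polynomial.finsetSum_coeff, Polynomial.finsetSum_coeff,
    coeff_zero_lax_monomial, add_comm, add_comm (_ * _), ← add_assoc]
  congr 1
  · congr 1
    · conv_lhs => rw [hm]
      rw [Finset.sum_range_succ]
      -- Lowering all the way to `w ^ 0` contributes nothing: the diagonal entry of `lax` at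
      -- exponent `0` is zero.
      have h0 : (lax (Polynomial.monomial (m + 1 - (m + 1))
          ((α * ((i : ℕ) : F)) • dp i f * p m.succPNat))).coeff 0 = 0 := by
        rw [Nat.sub_self, coeff_lax_self]
        simp
      rw [hm] at h0
      rw [h0, add_zero, hm, Nat.add_sub_cancel]
      refine Finset.sum_congr rfl fun k hk => ?_
      have hk' := Finset.mem_range.1 hk
      have h1 : m + 1 - (k + 1) = ((m + 1 - (k + 2)).succPNat : ℕ) := by
        rw [Nat.succPNat_coe]; omega
      have h2 : (m + 1 - (k + 2)).succPNat + k.succPNat = i := by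
        rw [← PNat.coe_inj, PNat.add_coe, Nat.succPNat_coe, Nat.succPNat_coe]; omega
      rw [h1, coeff_zero_lax_monomial, splitTerm]
      simp only [h2, hm]
      rw [mul_comm α, smul_mul_assoc, smul_mul_assoc]
      congr 1
      ring
    · refine Finset.sum_congr rfl fun j _ => ?_
      rw [Polynomial.X_pow_mul_monomial, ← PNat.add_coe, coeff_zero_lax_monomial, joinTerm,
        add_comm j i, dp_comm i j,
        show dp j ((α * (i : ℕ)) • dp i f) = (α * (i : ℕ)) • dp j (dp i f) from Derivation.map_smul _ _ _,
        smul_smul, smul_mul_assoc, mul_comm (dp j _)]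
      congr 1
      ring
  · rw [diagTerm, smul_smul, smul_smul, smul_mul_assoc, mul_comm (dp i f)]
    congr 1
    ring

theorem D_eq_moment : D = moment 3 := by
  refine LinearMap.ext fun f => ?_
  have h0 : lax (Polynomial.monomial 0 f) = powerDer f := by
    rw [lax_monomial]
    simp
  rw [moment_apply, pow_succ, pow_two, Module.End.mul_apply, Module.End.mul_apply, h0,
    powerDer_eq_sum f f.vars (dp_eq_zero_of_notMem f), map_sum, map_sum, Polynomial.finsetSum_coeff,
    Finset.sum_congr rfl fun i _ => coeff_zero_lax_lax f i, Finset.sum_add_distrib,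
    Finset.sum_add_distrib, ← Finset.smul_sum, ← finsum_splitTerm, ← finsum_joinTerm,
    ← finsum_diagTerm]
  rfl

/-! ### The Dunkl operator in the variable `x₀` -/

/-- Replace the exponents of `x₀` and `x_j` in a monomial. -/
noncomputable def upd (d : ℕ →₀ ℕ) (j a b : ℕ) : ℕ →₀ ℕ := (d.update 0 a).update j b

theorem upd_apply (d : ℕ →₀ ℕ) (j a b i : ℕ) :
    upd d j a b i = if i = j then b else if i = 0 then a else d i := by
  simp [upd, Finsupp.update_apply]

theorem upd_zero (d : ℕ →₀ ℕ) {j : ℕ} (hj : j ≠ 0) (a b : ℕ) : upd d j a b 0 = a := by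
  simp [upd_apply, hj.symm]

theorem upd_same (d : ℕ →₀ ℕ) (j a b : ℕ) : upd d j a b j = b := by
  simp [upd_apply]

theorem upd_self (d : ℕ →₀ ℕ) (j : ℕ) : upd d j (d 0) (d j) = d := by
  ext i
  rw [upd_apply]
  split_ifs with h h' <;> simp [*]

/-- The coefficient of `x₀ ^ x x_j ^ y` in `x_j / (x₀ - x_j) (1 - s) g`, where `s` exchanges `x₀`
and `x_j`, and `g` is given by its coefficients. -/
noncomputable def antiSum (g : ℕ → ℕ → F) (x y : ℕ) : F :=
  ∑ b ∈ Finset.range (x + 1), (g (x + y - b) b - g b (x + y - b))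

theorem antiSum_add (g h : ℕ → ℕ → F) (x y : ℕ) :
    antiSum (fun a b => g a b + h a b) x y = antiSum g x y + antiSum h x y := by
  simp only [antiSum, ← Finset.sum_add_distrib]
  exact Finset.sum_congr rfl fun _ _ => by ring

theorem antiSum_mul_left (c : F) (g : ℕ → ℕ → F) (x y : ℕ) :
    antiSum (fun a b => c * g a b) x y = c * antiSum g x y := by
  simp only [antiSum, Finset.mul_sum, mul_sub]

theorem antiSum_sum {ι : Type*} (R : Finset ι) (g : ι → ℕ → ℕ → F) (x y : ℕ) :
    antiSum (fun a b => ∑ i ∈ R, g i a b) x y = ∑ i ∈ R, antiSum (g i) x y := by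
  simp only [antiSum, ← Finset.sum_sub_distrib]
  rw [Finset.sum_comm]

/-- For `y = 0` the sum runs over a whole antidiagonal of an antisymmetric array. This is why the
infinite sum over `j` in the Dunkl operator is finite at each monomial. -/
theorem antiSum_zero_right (g : ℕ → ℕ → F) (x : ℕ) : antiSum g x 0 = 0 := by
  rw [antiSum, Finset.sum_sub_distrib, sub_eq_zero, ← Finset.sum_range_reflect]
  refine Finset.sum_congr rfl fun b hb => ?_
  have := Finset.mem_range.1 hb
  congr 1
  omega

/-- Multiplication by the symmetric polynomial `x₀ ^ k + x_j ^ k` commutes with `x_j / (x₀ - x_j) (1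
- s_j)`. -/
theorem antiSum_powerSum_mul (g : ℕ → ℕ → F) (k x y : ℕ) :
    antiSum (fun a b => (if k ≤ a then g (a - k) b else 0) + if k ≤ b then g a (b - k) else 0) x y =
      (if k ≤ x then antiSum g (x - k) y else 0) + if k ≤ y then antiSum g x (y - k) else 0 := by
  have h1 : ∑ b ∈ Finset.range (x + 1), (if k ≤ x + y - b then
      g (x + y - b - k) b - g b (x + y - b - k) else 0) =
        if k ≤ y then antiSum g x (y - k) else 0 := by
    split_ifs with hy
    · refine Finset.sum_congr rfl fun b hb => ?_
      have := Finset.mem_range.1 hb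
      rw [if_pos (by omega), show x + y - b - k = x + (y - k) - b by omega]
    -- When `y < k ≤ x + y`, the surviving terms form a full antidiagonal of degree `x + y - k` and
    -- cancel.
    · by_cases hn : k ≤ x + y
      · refine Eq.trans ?_ (antiSum_zero_right g (x + y - k))
        rw [antiSum, ← Finset.sum_filter]
        refine Finset.sum_congr ?_ fun b hb => ?_
        · ext b
          simp only [Finset.mem_filter, Finset.mem_range]
          omega
        · rw [show x + y - b - k = x + y - k + 0 - b by omega]
      · refine Finset.sum_eq_zero fun b _ => if_neg (by omega)
  have h2 : ∑ b ∈ Finset.range (x + 1), (if k ≤ b then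
      g (x + y - b) (b - k) - g (b - k) (x + y - b) else 0) =
        if k ≤ x then antiSum g (x - k) y else 0 := by
    split_ifs with hx
    · rw [show x + 1 = k + (x - k + 1) by omega, Finset.sum_range_add, Finset.sum_eq_zero, zero_add]
      · refine Finset.sum_congr rfl fun b hb => ?_
        rw [if_pos (by omega), show k + b - k = b by omega,
          show x + y - (k + b) = x - k + y - b by omega]
      · intro b hb
        have := Finset.mem_range.1 hb
        exact if_neg (by omega)
    · refine Finset.sum_eq_zero fun b hb => ?_
      have := Finset.mem_range.1 hb
      exact if_neg (by omega)
  rw [← h1, ← h2, antiSum, ← Finset.sum_add_distrib]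
  refine Finset.sum_congr rfl fun b _ => ?_
  split_ifs <;> ring

/-- The operator `α x₀ ∂/∂x₀ + ∑_{j ≥ 1} x_j / (x₀ - x_j) (1 - s_j)`, where `s_j` exchanges `x₀`
and `x_j`. -/
noncomputable def dunkl : Module.End F (MvPowerSeries ℕ F) where
  toFun f := fun d => α * d 0 * coeff d f +
    ∑ j ∈ d.support.erase 0, antiSum (fun a b => coeff (upd d j a b) f) (d 0) (d j)
  map_add' f g := by
    funext d
    simp only [map_add, antiSum_add, Finset.sum_add_distrib]
    change _ = (_ + _ : F) + (_ + _ : F)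
    ring
  map_smul' c f := by
    funext d
    simp only [map_smul, smul_eq_mul, antiSum_mul_left, ← Finset.mul_sum, RingHom.id_apply]
    change _ = c * (_ + _ : F)
    ring

theorem coeff_dunkl (f : MvPowerSeries ℕ F) (d : ℕ →₀ ℕ) (S : Finset ℕ)
    (hS : d.support.erase 0 ⊆ S) (h0 : 0 ∉ S) : coeff d (dunkl f) = α * d 0 * coeff d f +
      ∑ j ∈ S, antiSum (fun a b => coeff (upd d j a b) f) (d 0) (d j) := by
  change α * d 0 * coeff d f + ∑ j ∈ d.support.erase 0,
    antiSum (fun a b => coeff (upd d j a b) f) (d 0) (d j) = _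
  congr 1
  refine Finset.sum_subset hS fun j hj hj' => ?_
  have hj0 : d j = 0 := by
    by_contra h
    exact hj' (Finset.mem_erase.2 ⟨fun h => h0 (h ▸ hj), Finsupp.mem_support_iff.2 h⟩)
  rw [hj0, antiSum_zero_right]

theorem antiSum_coeff_mul_powerSumSeries (f : MvPowerSeries ℕ F) (k : ℕ+) (d : ℕ →₀ ℕ)
    (T : Finset ℕ) (hT : d.support ⊆ T) (h0 : 0 ∈ T) (j : ℕ) (hj : j ∈ T) (hj0 : j ≠ 0) :
    antiSum (fun a b => coeff (upd d j a b) (f * powerSumSeries k)) (d 0) (d j) =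
      ∑ i ∈ T, if (k : ℕ) ≤ d i then
        antiSum (fun a b => coeff (upd (d - Finsupp.single i (k : ℕ)) j a b) f)
          ((d - Finsupp.single i (k : ℕ)) 0) ((d - Finsupp.single i (k : ℕ)) j) else 0 := by
  classical
  obtain ⟨R, hR⟩ : ∃ R, R = (T.erase 0).erase j := ⟨_, rfl⟩
  have hsplit : ∀ φ : ℕ → F, ∑ i ∈ T, φ i = φ 0 + φ j + ∑ i ∈ R, φ i := by
    intro φ
    rw [← Finset.add_sum_erase T _ h0, ← Finset.add_sum_erase (T.erase 0) _
      (Finset.mem_erase.2 ⟨hj0, hj⟩), hR, add_assoc]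
  have hR' : ∀ i ∈ R, i ≠ 0 ∧ i ≠ j := by
    intro i hi
    rw [hR, Finset.mem_erase, Finset.mem_erase] at hi
    exact ⟨hi.2.1, hi.1⟩
  have h1 : ∀ a b, upd d j a b - Finsupp.single 0 (k : ℕ) = upd d j (a - k) b := by
    intro a b
    ext i
    rw [Finsupp.tsub_apply, upd_apply, upd_apply, Finsupp.single_apply]
    split_ifs <;> first | rfl | omega
  have h2 : ∀ a b, upd d j a b - Finsupp.single j (k : ℕ) = upd d j a (b - k) := by
    intro a b
    ext i
    rw [Finsupp.tsub_apply, upd_apply, upd_apply, Finsupp.single_apply]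
    split_ifs <;> first | rfl | omega
  have h3 : ∀ i ∈ R, ∀ a b, upd d j a b - Finsupp.single i (k : ℕ) =
      upd (d - Finsupp.single i (k : ℕ)) j a b := by
    intro i hi a b
    obtain ⟨hi1, hi2⟩ := hR' i hi
    ext l
    rw [Finsupp.tsub_apply, upd_apply, upd_apply, Finsupp.tsub_apply, Finsupp.single_apply]
    split_ifs <;> first | rfl | omega
  have h4 : ∀ a b, upd (d - Finsupp.single 0 (k : ℕ)) j a b = upd d j a b := by
    intro a b
    ext l
    rw [upd_apply, upd_apply, Finsupp.tsub_apply, Finsupp.single_apply]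
    split_ifs <;> first | rfl | omega
  have h5 : ∀ a b, upd (d - Finsupp.single j (k : ℕ)) j a b = upd d j a b := by
    intro a b
    ext l
    rw [upd_apply, upd_apply, Finsupp.tsub_apply, Finsupp.single_apply]
    split_ifs <;> first | rfl | omega
  have hcoeff : ∀ a b, coeff (upd d j a b) (f * powerSumSeries k) =
      ((if (k : ℕ) ≤ a then coeff (upd d j (a - k) b) f else 0) +
        if (k : ℕ) ≤ b then coeff (upd d j a (b - k)) f else 0) +
      ∑ i ∈ R, (if (k : ℕ) ≤ d i then 1 else 0) *
        coeff (upd (d - Finsupp.single i (k : ℕ)) j a b) f := by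
    intro a b
    rw [coeff_mul_powerSumSeries f k _ T, hsplit, upd_zero _ hj0, upd_same, h1, h2]
    · congr 1
      refine Finset.sum_congr rfl fun i hi => ?_
      rw [h3 i hi, upd_apply, if_neg (hR' i hi).2, if_neg (hR' i hi).1]
      split_ifs <;> simp
    · intro i hi
      rw [Finsupp.mem_support_iff, upd_apply] at hi
      split_ifs at hi with hij hi0
      · exact hij ▸ hj
      · exact hi0 ▸ h0
      · exact hT (Finsupp.mem_support_iff.2 hi)
  simp only [hcoeff]
  rw [antiSum_add, antiSum_sum, antiSum_powerSum_mul (fun a b => coeff (upd d j a b) f), hsplit]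
  simp only [h4, h5, antiSum_mul_left]
  congr 1
  · simp [hj0, hj0.symm]
  · refine Finset.sum_congr rfl fun i hi => ?_
    obtain ⟨hi1, hi2⟩ := hR' i hi
    simp [hi1, hi2]

/-- The exchange terms commute with the symmetric `p_k`; only `α x₀ ∂/∂x₀` contributes a commutator,
namely `α k x₀ ^ k`. -/
theorem dunkl_mul_powerSumSeries (f : MvPowerSeries ℕ F) (k : ℕ+) :
    dunkl (f * powerSumSeries k) = dunkl f * powerSumSeries k +
      (α * (k : ℕ)) • (f * MvPowerSeries.X 0 ^ (k : ℕ)) := by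
  classical
  ext d
  set S := d.support.erase 0
  have h0S : 0 ∉ S := Finset.notMem_erase _ _
  set T := insert 0 S
  have hT : d.support ⊆ T := Finset.insert_erase_subset 0 d.support
  have hX : coeff d (f * MvPowerSeries.X 0 ^ (k : ℕ)) =
      if (k : ℕ) ≤ d 0 then coeff (d - Finsupp.single 0 (k : ℕ)) f else 0 := by
    rw [MvPowerSeries.X_pow_eq, MvPowerSeries.coeff_mul_monomial]
    simp only [Finsupp.single_le_iff, mul_one]
  have hd : ∀ i, coeff (d - Finsupp.single i (k : ℕ)) (dunkl f) =
      α * (d - Finsupp.single i (k : ℕ)) 0 * coeff (d - Finsupp.single i (k : ℕ)) f +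
      ∑ j ∈ S, antiSum (fun a b => coeff (upd (d - Finsupp.single i (k : ℕ)) j a b) f)
        ((d - Finsupp.single i (k : ℕ)) 0) ((d - Finsupp.single i (k : ℕ)) j) := fun i =>
    coeff_dunkl f _ S (Finset.erase_subset_erase _ (Finsupp.support_mono tsub_le_self)) h0S
  rw [coeff_dunkl _ d S subset_rfl h0S, map_add, map_smul, hX, smul_eq_mul,
    coeff_mul_powerSumSeries f k d T hT, coeff_mul_powerSumSeries (dunkl f) k d T hT]
  have hsum : ∑ j ∈ S, antiSum (fun a b => coeff (upd d j a b) (f * powerSumSeries k)) (d 0) (d j) =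
      ∑ i ∈ T, if (k : ℕ) ≤ d i then ∑ j ∈ S,
        antiSum (fun a b => coeff (upd (d - Finsupp.single i (k : ℕ)) j a b) f)
          ((d - Finsupp.single i (k : ℕ)) 0) ((d - Finsupp.single i (k : ℕ)) j) else 0 := by
    rw [Finset.sum_congr rfl fun j hj => antiSum_coeff_mul_powerSumSeries f k d T hT
      (Finset.mem_insert_self _ _) j (Finset.mem_insert_of_mem hj) (fun h => h0S (h ▸ hj)),
      Finset.sum_comm]
    refine Finset.sum_congr rfl fun i _ => ?_
    split_ifs
    · rfl
    · simp
  rw [hsum]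
  simp only [hd]
  rw [Finset.sum_insert h0S, Finset.sum_insert h0S, Finset.sum_insert h0S, mul_add, Finset.mul_sum]
  have hrest : ∀ i ∈ S, (if (k : ℕ) ≤ d i then α * ((d - Finsupp.single i (k : ℕ)) 0 : ℕ) *
      coeff (d - Finsupp.single i (k : ℕ)) f + ∑ j ∈ S,
        antiSum (fun a b => coeff (upd (d - Finsupp.single i (k : ℕ)) j a b) f)
          ((d - Finsupp.single i (k : ℕ)) 0) ((d - Finsupp.single i (k : ℕ)) j) else 0) =
      (α * d 0 * if (k : ℕ) ≤ d i then coeff (d - Finsupp.single i (k : ℕ)) f else 0) +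
      if (k : ℕ) ≤ d i then ∑ j ∈ S,
        antiSum (fun a b => coeff (upd (d - Finsupp.single i (k : ℕ)) j a b) f)
          ((d - Finsupp.single i (k : ℕ)) 0) ((d - Finsupp.single i (k : ℕ)) j) else 0 := by
    intro i hi
    have : (d - Finsupp.single i (k : ℕ)) 0 = d 0 := by
      have hi0 : i ≠ 0 := fun h => h0S (h ▸ hi)
      simp [hi0]
    rw [this]
    split_ifs <;> ring
  rw [Finset.sum_congr rfl hrest, Finset.sum_add_distrib]
  by_cases hk : (k : ℕ) ≤ d 0
  · have : (d - Finsupp.single (0 : ℕ) (k : ℕ)) 0 = d 0 - (k : ℕ) := by simp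
    simp only [if_pos hk]
    rw [show (((d - Finsupp.single (0 : ℕ) (k : ℕ)) 0 : ℕ) : F) = (d 0 : F) - ((k : ℕ) : F) by
      rw [this, Nat.cast_sub hk]]
    ring
  · simp only [if_neg hk]
    ring

/-! ### Intertwining of the Lax and Dunkl operators -/

/-- The homomorphism from `Λ_F[w]` to power series that extends `toSeries` and maps `w` to `x₀`. -/
noncomputable def polySeries : Polynomial SymFun →+* MvPowerSeries ℕ F :=
  Polynomial.eval₂RingHom toSeries.toRingHom (MvPowerSeries.X 0)

theorem polySeries_monomial (a : ℕ) (f : SymFun) :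
    polySeries (Polynomial.monomial a f) = toSeries f * MvPowerSeries.X 0 ^ a := by
  simp [polySeries]

theorem polySeries_C (f : SymFun) : polySeries (Polynomial.C f) = toSeries f := by
  simp [polySeries]

theorem polySeries_X : polySeries Polynomial.X = MvPowerSeries.X 0 := by
  simp [polySeries]

theorem polySeries_smul (c : F) (G : Polynomial SymFun) : polySeries (c • G) = c • polySeries G := by
  rw [show c • G = Polynomial.C (MvPolynomial.C c) * G by
    rw [← Polynomial.smul_eq_C_mul, ← MvPolynomial.algebraMap_eq, algebraMap_smul], map_mul,
    polySeries_C, ← MvPolynomial.algebraMap_eq, AlgHom.commutes, Algebra.smul_def]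

theorem coeff_X_pow_mul_powerSumSeries (d : ℕ →₀ ℕ) (m : ℕ) (k : ℕ+) (T : Finset ℕ)
    (hT : d.support ⊆ T) : coeff d (powerSumSeries k * MvPowerSeries.X 0 ^ m) =
      ∑ i ∈ T, if d = Finsupp.single i (k : ℕ) + Finsupp.single 0 m then 1 else 0 := by
  classical
  rw [mul_comm, coeff_mul_powerSumSeries _ k d T hT]
  refine Finset.sum_congr rfl fun i _ => ?_
  rw [MvPowerSeries.coeff_X_pow]
  by_cases h : (k : ℕ) ≤ d i
  · rw [if_pos h]
    congr 1
    rw [tsub_eq_iff_eq_add_of_le (Finsupp.single_le_iff.2 h), add_comm]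
  · rw [if_neg h, if_neg]
    intro h'
    apply h
    rw [h']
    simp

/-- The geometric sum gives `x_j (x₀ ^ a - x_j ^ a) / (x₀ - x_j) = ∑_{k < a} x_j ^ (k + 1) x₀ ^ (a -
k - 1)`. Summing over `j ≥ 1` leaves out the `j = 0` part of each power sum, which is `x₀ ^ a` each
time; this turns `α a` into `(α - 1) a`. -/
theorem dunkl_X_pow (a : ℕ) : dunkl (MvPowerSeries.X 0 ^ a) =
    ((α - 1) * a) • MvPowerSeries.X 0 ^ a +
      ∑ k ∈ Finset.range a, powerSumSeries k.succPNat * MvPowerSeries.X 0 ^ (a - (k + 1)) := by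
  classical
  ext d
  set S := d.support.erase 0
  have h0S : 0 ∉ S := Finset.notMem_erase _ _
  set T := insert 0 S
  have hT : d.support ⊆ T := Finset.insert_erase_subset 0 d.support
  have hc : ∀ k : ℕ, coeff d (powerSumSeries k.succPNat * MvPowerSeries.X 0 ^ (a - (k + 1))) =
      ∑ i ∈ T, if d = Finsupp.single i (k + 1) + Finsupp.single 0 (a - (k + 1)) then 1 else 0 :=
    fun k => coeff_X_pow_mul_powerSumSeries d _ _ T hT
  rw [coeff_dunkl _ d S subset_rfl h0S, map_add, map_smul, map_sum, smul_eq_mul,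
    Finset.sum_congr rfl fun k _ => hc k, Finset.sum_comm, Finset.sum_insert h0S]
  simp only [MvPowerSeries.coeff_X_pow]
  have hzero : ∑ k ∈ Finset.range a,
      (if d = Finsupp.single 0 (k + 1) + Finsupp.single 0 (a - (k + 1)) then (1 : F) else 0) =
      a * if d = Finsupp.single 0 a then 1 else 0 := by
    rw [Finset.sum_congr rfl (g := fun _ => if d = Finsupp.single 0 a then (1 : F) else 0)]
    · simp
    · intro k hk
      have := Finset.mem_range.1 hk
      rw [← Finsupp.single_add, Nat.add_sub_cancel' (by omega)]
  have hj : ∀ j ∈ S, antiSum (fun x y => if upd d j x y = Finsupp.single 0 a then (1 : F) else 0)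
      (d 0) (d j) = ∑ k ∈ Finset.range a,
        if d = Finsupp.single j (k + 1) + Finsupp.single 0 (a - (k + 1)) then (1 : F) else 0 := by
    intro j hj
    have hj0 : j ≠ 0 := fun h => h0S (h ▸ hj)
    have hdj : d j ≠ 0 := Finsupp.mem_support_iff.1 (Finset.mem_of_mem_erase hj)
    have hiff : ∀ x y, upd d j x y = Finsupp.single 0 a ↔
        (∀ i, i ≠ 0 → i ≠ j → d i = 0) ∧ x = a ∧ y = 0 := by
      intro x y
      constructor
      · intro h
        refine ⟨fun i hi hij => ?_, ?_, ?_⟩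
        · have := DFunLike.congr_fun h i
          simpa [upd_apply, hi, hij, Finsupp.single_apply, hi.symm] using this
        · have := DFunLike.congr_fun h 0
          simpa [upd_zero _ hj0] using this
        · have := DFunLike.congr_fun h j
          simpa [upd_same, Finsupp.single_apply, hj0.symm] using this
      · rintro ⟨h, rfl, rfl⟩
        ext i
        rw [upd_apply, Finsupp.single_apply]
        split_ifs with h1 h2 h2 h3 h3 <;> first | rfl | (subst_vars; omega) | skip
        all_goals exact h i (by omega) (by omega)
    have hiff' : ∀ k, d = Finsupp.single j (k + 1) + Finsupp.single 0 (a - (k + 1)) ↔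
        (∀ i, i ≠ 0 → i ≠ j → d i = 0) ∧ d j = k + 1 ∧ d 0 = a - (k + 1) := by
      intro k
      constructor
      · intro h
        refine ⟨fun i hi hij => ?_, ?_, ?_⟩ <;> rw [h] <;>
          (simp [Finsupp.single_apply, *, Ne.symm, eq_comm]; try omega)
      · rintro ⟨h, h1, h2⟩
        ext i
        rw [Finsupp.add_apply, Finsupp.single_apply, Finsupp.single_apply]
        by_cases hi : i = 0
        · subst hi; simp [h2, hj0]
        · by_cases hij : i = j
          · subst hij; simp [h1, hj0.symm]
          · simp [h i hi hij, Ne.symm hi, Ne.symm hij]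
    simp only [hiff, hiff', antiSum]
    by_cases hQ : ∀ i, i ≠ 0 → i ≠ j → d i = 0
    · simp only [and_iff_right hQ]
      -- Only `b = 0` can meet the monomial `x₀ ^ a`; the reflected term never does, because the
      -- exponent of `x_j` in `d` is positive.
      rw [Finset.sum_eq_single 0]
      · by_cases ha : d 0 + d j = a
        · rw [if_pos ⟨by omega, rfl⟩, if_neg (by omega), sub_zero, Finset.sum_eq_single (d j - 1),
            if_pos (by omega)]
          · intro k _ hk
            exact if_neg (by omega)
          · intro h
            rw [Finset.mem_range] at h
            omega
        · rw [if_neg (by omega), if_neg (by omega), sub_zero, Finset.sum_eq_zero]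
          intro k hk
          have := Finset.mem_range.1 hk
          exact if_neg (by omega)
      · intro b hb hb0
        have := Finset.mem_range.1 hb
        rw [if_neg (by omega), if_neg (by omega), sub_zero]
      · intro h
        simp at h
    · simp [hQ]
  rw [hzero, Finset.sum_congr rfl hj]
  by_cases h : d = Finsupp.single 0 a
  · have : d 0 = a := by rw [h]; simp
    rw [if_pos h, this]
    ring
  · rw [if_neg h]
    ring

/-- Both operators agree on powers of `w = x₀` and have the same commutator with multiplication by
each `p_k`, and these generate `Λ_F[w]`. -/
theorem polySeries_lax (G : Polynomial SymFun) : polySeries (lax G) = dunkl (polySeries G) := by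
  induction G using Polynomial.induction_on' with
  | add G H hG hH => rw [map_add, map_add, map_add, map_add, hG, hH]
  | monomial a f =>
    induction f using MvPolynomial.induction_on with
    | C c =>
      have h1 : (MvPolynomial.C c : SymFun) = c • 1 := by
        rw [MvPolynomial.smul_eq_C_mul, mul_one]
      rw [h1, ← Polynomial.smul_monomial, map_smul, polySeries_smul, polySeries_smul, map_smul,
        polySeries_monomial, map_one toSeries, one_mul, dunkl_X_pow, lax_monomial, Derivation.map_one_eq_zero,
        mul_zero, add_zero, map_add, map_sum, ← Polynomial.smul_monomial, polySeries_smul,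
        polySeries_monomial, map_one toSeries, one_mul]
      congr 2
      refine Finset.sum_congr rfl fun k _ => ?_
      rw [polySeries_monomial, one_mul, toSeries_p]
    | add f g hf hg => rw [map_add, map_add, map_add, map_add, map_add, hf, hg]
    | mul_X f k hf =>
      have hder : powerDer (p k) =
          (α * (k : ℕ)) • (Polynomial.X ^ (k : ℕ) : Polynomial SymFun) := by
        rw [powerDer, MvPolynomial.mkDerivation_X, Polynomial.X_pow_eq_monomial,
          Polynomial.smul_monomial, MvPolynomial.smul_eq_C_mul, mul_one]
      have h1 : lax (Polynomial.monomial a (f * p k)) = lax (Polynomial.monomial a f) *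
          Polynomial.C (p k) + (α * (k : ℕ)) • (Polynomial.monomial a f * Polynomial.X ^ (k : ℕ)) := by
        rw [lax_monomial, lax_monomial, Derivation.leibniz, hder, add_mul, add_mul,
          Polynomial.monomial_mul_C, Finset.sum_mul, smul_mul_assoc,
          Polynomial.smul_eq_C_mul, Polynomial.smul_eq_C_mul]
        simp only [Polynomial.monomial_mul_C]
        rw [Finset.sum_congr rfl fun i _ => by rw [mul_right_comm f (p k)],
          ← Polynomial.C_mul_X_pow_eq_monomial (a := f)]
        simp only [mul_smul_comm, mul_add]
        rw [show Polynomial.X ^ a * (Polynomial.C f * Polynomial.X ^ (k : ℕ)) =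
          Polynomial.C f * Polynomial.X ^ a * Polynomial.X ^ (k : ℕ) by ring]
        ring
      have h2 : polySeries (Polynomial.monomial a (f * p k)) =
          polySeries (Polynomial.monomial a f) * powerSumSeries k := by
        rw [polySeries_monomial, polySeries_monomial, map_mul, toSeries_p]
        ring
      change polySeries (lax (Polynomial.monomial a (f * p k))) =
        dunkl (polySeries (Polynomial.monomial a (f * p k)))
      rw [h1, h2, dunkl_mul_powerSumSeries, map_add, map_mul, hf, polySeries_C, toSeries_p,
        polySeries_smul, map_mul, map_pow, polySeries_X]

theorem coeff_polySeries (G : Polynomial SymFun) (d : ℕ →₀ ℕ) (hd : d 0 = 0) :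
    coeff d (polySeries G) = coeff d (toSeries (G.coeff 0)) := by
  classical
  induction G using Polynomial.induction_on' with
  | add G H hG hH => rw [map_add, map_add, hG, hH, Polynomial.coeff_add, map_add, map_add]
  | monomial a f =>
    rw [polySeries_monomial, Polynomial.coeff_monomial]
    rcases Nat.eq_zero_or_pos a with rfl | ha
    · simp
    · rw [if_neg (by omega), MvPowerSeries.X_pow_eq, MvPowerSeries.coeff_mul_monomial, if_neg]
      · simp
      · rw [Finsupp.single_le_iff]
        omega

theorem coeff_toSeries_moment (k : ℕ) (f : SymFun) (d : ℕ →₀ ℕ) (hd : d 0 = 0) :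
    coeff d (toSeries (moment k f)) = coeff d ((dunkl ^ k) (toSeries f)) := by
  have h : ∀ G, polySeries ((lax ^ k) G) = (dunkl ^ k) (polySeries G) := by
    induction k with
    | zero => intro G; rfl
    | succ k ih =>
      intro G
      rw [pow_succ, pow_succ, Module.End.mul_apply, Module.End.mul_apply, ih, polySeries_lax]
  rw [moment_apply, ← coeff_polySeries _ d hd, h, polySeries_monomial, pow_zero, mul_one]

/-! ### Triangularity of the moments -/

theorem exps_upd (d : ℕ →₀ ℕ) {j : ℕ} (hj : j ≠ 0) (a b : ℕ) :
    exps (upd d j a b) = singleNZ a + (singleNZ b + exps ((d.erase 0).erase j)) := by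
  have h : ((upd d j a b).erase 0).erase j = (d.erase 0).erase j := by
    ext i
    by_cases hij : i = j
    · simp [hij]
    · by_cases hi : i = 0
      · subst hi; simp [Finsupp.erase_ne hij]
      · rw [Finsupp.erase_ne hij, Finsupp.erase_ne hij, Finsupp.erase_ne hi, Finsupp.erase_ne hi,
          upd_apply, if_neg hij, if_neg hi]
  rw [exps_eq_add_erase _ 0, exps_eq_add_erase ((upd d j a b).erase 0) j, h, Finsupp.erase_ne hj,
    upd_zero d hj, upd_same]

theorem exps_eq_of_ne_zero (d : ℕ →₀ ℕ) {j : ℕ} (hj : j ≠ 0) :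
    exps d = singleNZ (d 0) + (singleNZ (d j) + exps ((d.erase 0).erase j)) := by
  conv_lhs => rw [← upd_self d j, exps_upd d hj]

theorem sum_le_topSum_exps (d : ℕ →₀ ℕ) (T : Finset ℕ) (i : ℕ) (hT : T.card ≤ i) :
    ∑ t ∈ T, d t ≤ topSum (exps d) i := by
  have h1 : ∑ t ∈ T, d t = ((T.filter fun t => d t ≠ 0).val.map d).sum :=
    (Finset.sum_filter_ne_zero T).symm
  rw [h1]
  refine sum_le_topSum ?_ i ?_
  · refine Multiset.map_le_map (Finset.val_le_iff.2 fun t ht => ?_)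
    exact Finsupp.mem_support_iff.2 (Finset.mem_filter.1 ht).2
  · rw [Multiset.card_map]
    exact (Finset.card_filter_le _ _).trans hT

theorem exists_topSum_exps_eq (d : ℕ →₀ ℕ) (i : ℕ) :
    ∃ T : Finset ℕ, T.card ≤ i ∧ topSum (exps d) i = ∑ t ∈ T, d t := by
  obtain ⟨t, ht, hi, hs⟩ := exists_sum_eq_topSum (exps d) i
  obtain ⟨u, hu, rfl⟩ := exists_le_map_eq d _ t ht
  refine ⟨⟨u, Multiset.nodup_of_le hu d.support.nodup⟩, by simpa using hi, hs.symm⟩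

/-- Spreading two exponents apart at fixed sum moves up in dominance. A set of positions containing
exactly one of `0` and `j` is compared with the set that contains the position of `max a b` instead.
-/
theorem dom_exps_upd (d : ℕ →₀ ℕ) {j : ℕ} (hj : j ≠ 0) (a b : ℕ) (hab : a + b = d 0 + d j)
    (h0 : d 0 ≤ max a b) (h1 : d j ≤ max a b) : Dom (exps d) (exps (upd d j a b)) := by
  classical
  refine ⟨?_, fun i => ?_⟩
  · rw [exps_upd d hj, exps_eq_of_ne_zero d hj]
    simp only [Multiset.sum_add, sum_singleNZ]
    omega
  obtain ⟨T, hT, hsum⟩ := exists_topSum_exps_eq d i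
  rw [hsum]
  obtain ⟨R, hR⟩ : ∃ R, R = (T.erase 0).erase j := ⟨_, rfl⟩
  have h0R : 0 ∉ R := by simp [hR]
  have hjR : j ∉ R := by simp [hR]
  have hRsum : ∑ t ∈ R, upd d j a b t = ∑ t ∈ R, d t := by
    refine Finset.sum_congr rfl fun t ht => ?_
    rw [upd_apply, if_neg (fun h : t = j => hjR (h ▸ ht)),
      if_neg (fun h : t = 0 => h0R (h ▸ ht))]
  have key : ∀ e : ℕ, e ≤ max a b → T.card = R.card + 1 → ∑ t ∈ T, d t = e + ∑ t ∈ R, d t →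
      ∑ t ∈ T, d t ≤ topSum (exps (upd d j a b)) i := by
    intro e he hc hs
    rcases le_total a b with hle | hle
    · rw [max_eq_right hle] at he
      refine le_trans ?_ (sum_le_topSum_exps (upd d j a b) (insert j R) i ?_)
      · rw [Finset.sum_insert hjR, hRsum, upd_same]
        omega
      · rw [Finset.card_insert_of_notMem hjR]
        omega
    · rw [max_eq_left hle] at he
      refine le_trans ?_ (sum_le_topSum_exps (upd d j a b) (insert 0 R) i ?_)
      · rw [Finset.sum_insert h0R, hRsum, upd_zero d hj]
        omega
      · rw [Finset.card_insert_of_notMem h0R]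
        omega
  by_cases h0T : 0 ∈ T
  · by_cases hjT : j ∈ T
    · have hins : T = insert 0 (insert j R) := by
        rw [hR, Finset.insert_erase (Finset.mem_erase.2 ⟨hj, hjT⟩), Finset.insert_erase h0T]
      refine le_trans (le_of_eq ?_) (sum_le_topSum_exps (upd d j a b) T i hT)
      have h0' : 0 ∉ insert j R := by simp [h0R, hj.symm]
      rw [hins, Finset.sum_insert h0', Finset.sum_insert h0', Finset.sum_insert hjR,
        Finset.sum_insert hjR, hRsum, upd_zero d hj, upd_same]
      omega
    · have hins : T = insert 0 R := by
        rw [hR, Finset.erase_eq_of_notMem (fun h => hjT (Finset.mem_of_mem_erase h)),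
          Finset.insert_erase h0T]
      refine key (d 0) h0 ?_ ?_
      · rw [hins, Finset.card_insert_of_notMem h0R]
      · rw [hins, Finset.sum_insert h0R]
  · by_cases hjT : j ∈ T
    · have hins : T = insert j R := by
        rw [hR, Finset.erase_eq_of_notMem h0T, Finset.insert_erase hjT]
      refine key (d j) h1 ?_ ?_
      · rw [hins, Finset.card_insert_of_notMem hjR]
      · rw [hins, Finset.sum_insert hjR]
    · have hins : T = R := by
        rw [hR, Finset.erase_eq_of_notMem h0T, Finset.erase_eq_of_notMem hjT]
      refine le_trans (le_of_eq ?_) (sum_le_topSum_exps (upd d j a b) T i hT)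
      rw [hins, hRsum]

/-- The terms `y ≤ b ≤ x` cancel in pairs. In those that remain, the exponents are spread at least
as far apart as `(x, y)`, which is the source of triangularity. -/
theorem antiSum_eq_sum_min (g : ℕ → ℕ → F) (x y : ℕ) : antiSum g x y =
    ∑ b ∈ Finset.range (min (x + 1) y), (g (x + y - b) b - g b (x + y - b)) := by
  rcases lt_or_ge x y with h | h
  · rw [min_eq_left (by omega), antiSum]
  · rw [min_eq_right (by omega), antiSum, show x + 1 = y + (x - y + 1) by omega,
      Finset.sum_range_add, add_eq_left]
    have := antiSum_zero_right (fun a b => g (y + a) (y + b)) (x - y)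
    rw [antiSum] at this
    rw [← this]
    refine Finset.sum_congr rfl fun b hb => ?_
    have := Finset.mem_range.1 hb
    rw [show x + y - (y + b) = y + (x - y + 0 - b) by omega]

/-- The coefficients of `f` at monomials whose exponents are not dominated by `s` vanish, and those
at monomials with exponents `s` are given by `r`, in terms of the exponent of `x₀`. -/
def IsTriangular (s : Multiset ℕ) (r : ℕ → F) (f : MvPowerSeries ℕ F) : Prop :=
  (∀ d, coeff d f ≠ 0 → Dom (exps d) s) ∧ ∀ d, exps d = s → coeff d f = r (d 0)

theorem IsTriangular.coeff_upd_eq_zero {s : Multiset ℕ} {r : ℕ → F} {f : MvPowerSeries ℕ F}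
    (hf : IsTriangular s r f) (d : ℕ →₀ ℕ) (hd : exps d = s) {j : ℕ} (hj : j ≠ 0) (a b : ℕ)
    (hab : a + b = d 0 + d j) (h0 : d 0 < max a b) (h1 : d j < max a b) :
    coeff (upd d j a b) f = 0 := by
  by_contra h
  have h2 := hf.1 _ h
  rw [← hd] at h2
  have h3 := Dom.antisymm (zero_notMem_exps _) (zero_notMem_exps _) h2
    (dom_exps_upd d hj a b hab h0.le h1.le)
  rw [exps_upd d hj, exps_eq_of_ne_zero d hj] at h3
  -- Two pairs with equal sums and different maxima have different sums of squares.
  have h4 := congrArg (fun t : Multiset ℕ => (t.map (· ^ 2)).sum) h3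
  have h5 : ∀ m : ℕ, ((singleNZ m).map (· ^ 2)).sum = m ^ 2 := by
    intro m
    unfold singleNZ
    split_ifs with hm <;> simp [hm]
  simp only [Multiset.map_add, Multiset.sum_add, h5] at h4
  rcases le_total a b with hle | hle
  · rw [max_eq_right hle] at h0 h1
    obtain ⟨u, rfl⟩ := Nat.exists_eq_add_of_lt h0
    have : d j = a + u + 1 := by omega
    rw [this] at h4 h1
    nlinarith
  · rw [max_eq_left hle] at h0 h1
    obtain ⟨u, rfl⟩ := Nat.exists_eq_add_of_lt h0
    have : d j = b + u + 1 := by omega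
    rw [this] at h4 h1
    nlinarith

/-- All terms come from monomials that dominate the given one. On the diagonal only the exchange
`s_j` itself survives, and only when `x_j` has the larger exponent. Since the operator singles out
`x₀`, the diagonal value has to be tracked as a function of the exponent of `x₀`. -/
theorem IsTriangular.dunkl {s : Multiset ℕ} {r : ℕ → F} {f : MvPowerSeries ℕ F}
    (hf : IsTriangular s r f) : IsTriangular s
      (fun u => α * u * r u + (s.map fun v => if u < v then r v - r u else 0).sum)
      (JackSym.dunkl f) := by
  refine ⟨fun d hd => ?_, fun d hd => ?_⟩
  · by_cases h : coeff d f = 0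
    · rw [coeff_dunkl f d _ subset_rfl (Finset.notMem_erase _ _), h, mul_zero, zero_add] at hd
      obtain ⟨j, hj, hne⟩ := Finset.exists_ne_zero_of_sum_ne_zero hd
      have hj0 := Finset.ne_of_mem_erase hj
      rw [antiSum_eq_sum_min] at hne
      obtain ⟨b, hb, hne⟩ := Finset.exists_ne_zero_of_sum_ne_zero hne
      have hb' := Finset.mem_range.1 hb
      by_cases h1 : coeff (upd d j (d 0 + d j - b) b) f = 0
      · rw [h1, zero_sub, neg_ne_zero] at hne
        exact (dom_exps_upd d hj0 _ _ (by omega) (by omega) (by omega)).trans (hf.1 _ hne)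
      · exact (dom_exps_upd d hj0 _ _ (by omega) (by omega) (by omega)).trans (hf.1 _ h1)
    · exact hf.1 d h
  · rw [coeff_dunkl f d _ subset_rfl (Finset.notMem_erase _ _), hf.2 d hd]
    congr 1
    have hterm : ∀ j ∈ d.support.erase 0,
        antiSum (fun a b => coeff (upd d j a b) f) (d 0) (d j) =
          if d 0 < d j then r (d j) - r (d 0) else 0 := by
      intro j hj
      have hj0 := Finset.ne_of_mem_erase hj
      have hzero : ∀ b, b < d 0 → b < d j → coeff (upd d j (d 0 + d j - b) b) f -
          coeff (upd d j b (d 0 + d j - b)) f = 0 := by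
        intro b hb hb'
        rw [hf.coeff_upd_eq_zero d hd hj0 _ _ (by omega) (by omega) (by omega),
          hf.coeff_upd_eq_zero d hd hj0 _ _ (by omega) (by omega) (by omega), sub_zero]
      rw [antiSum_eq_sum_min]
      split_ifs with h
      · rw [min_eq_left (by omega), Finset.sum_range_succ, Finset.sum_eq_zero, zero_add,
          Nat.add_sub_cancel_left, upd_self, hf.2 d hd, hf.2, upd_zero d hj0]
        · rw [exps_upd d hj0, ← hd, exps_eq_of_ne_zero d hj0, add_left_comm]
        · intro b hb
          have := Finset.mem_range.1 hb
          exact hzero b this (by omega)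
      · rw [min_eq_right (by omega)]
        refine Finset.sum_eq_zero fun b hb => ?_
        have := Finset.mem_range.1 hb
        exact hzero b (by omega) this
    rw [Finset.sum_congr rfl hterm, ← hd,
      ← sum_support_eq d (fun v => if d 0 < v then r v - r (d 0) else 0)]
    exact Finset.sum_erase _ (by simp)

/-- The diagonal coefficients of the powers of the Dunkl operator, as polynomials in `α`. -/
noncomputable def diagPoly (s : Multiset ℕ) : ℕ → ℕ → Polynomial ℚ
  | 0, _ => 1
  | k + 1, u => Polynomial.X * (u : Polynomial ℚ) * diagPoly s k u +
      (s.map fun v => if u < v then diagPoly s k v - diagPoly s k u else 0).sum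

theorem coeff_multiset_sum_map {ι : Type*} (s : Multiset ι) (g : ι → Polynomial ℚ) (n : ℕ) :
    ((s.map g).sum).coeff n = (s.map fun v => (g v).coeff n).sum := by
  rw [← Polynomial.lcoeff_apply, map_multiset_sum, Multiset.map_map]
  rfl

theorem coeff_diagPoly_eq_zero (s : Multiset ℕ) (k u n : ℕ) (h : k < n) :
    (diagPoly s k u).coeff n = 0 := by
  induction k generalizing u n with
  | zero => rw [diagPoly, Polynomial.coeff_one, if_neg (by omega)]
  | succ k ih =>
    obtain ⟨n, rfl⟩ : ∃ n', n = n' + 1 := ⟨n - 1, by omega⟩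
    rw [diagPoly, Polynomial.coeff_add, mul_assoc, Polynomial.coeff_X_mul, coeff_multiset_sum_map,
      ← Polynomial.C_eq_natCast, Polynomial.coeff_C_mul, ih u n (by omega), mul_zero, zero_add]
    refine Multiset.sum_eq_zero fun x hx => ?_
    obtain ⟨v, -, rfl⟩ := Multiset.mem_map.1 hx
    split_ifs
    · rw [Polynomial.coeff_sub, ih _ _ (by omega), ih _ _ (by omega), sub_zero]
    · rw [Polynomial.coeff_zero]

/-- The exchange terms do not raise the degree in `α`, so the top coefficient comes from `α u`
alone. -/
theorem coeff_diagPoly (s : Multiset ℕ) (k u : ℕ) : (diagPoly s k u).coeff k = (u : ℚ) ^ k := by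
  induction k generalizing u with
  | zero => simp [diagPoly]
  | succ k ih =>
    rw [diagPoly, Polynomial.coeff_add, mul_assoc, Polynomial.coeff_X_mul, coeff_multiset_sum_map,
      ← Polynomial.C_eq_natCast, Polynomial.coeff_C_mul, ih, Multiset.sum_eq_zero, add_zero, pow_succ']
    intro x hx
    obtain ⟨v, -, rfl⟩ := Multiset.mem_map.1 hx
    split_ifs
    · rw [Polynomial.coeff_sub, coeff_diagPoly_eq_zero _ _ _ _ (by omega),
        coeff_diagPoly_eq_zero _ _ _ _ (by omega), sub_zero]
    · rw [Polynomial.coeff_zero]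

/-- At `u = 0` the term `α u` vanishes and every part `v` satisfies `0 < v`, so the coefficient is
the sum of `v ^ k - 0 ^ k`. -/
theorem coeff_diagPoly_zero (s : Multiset ℕ) (hs : 0 ∉ s) (k : ℕ) (hk : 1 ≤ k) :
    (diagPoly s (k + 1) 0).coeff k = (s.map fun v : ℕ => (v : ℚ) ^ k).sum := by
  rw [diagPoly, Nat.cast_zero, mul_zero, zero_mul, zero_add, coeff_multiset_sum_map]
  congr 1
  refine Multiset.map_congr rfl fun v hv => ?_
  have hv0 : 0 < v := Nat.pos_of_ne_zero fun h => hs (h ▸ hv)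
  rw [if_pos hv0, Polynomial.coeff_sub, coeff_diagPoly, coeff_diagPoly, Nat.cast_zero,
    zero_pow (by omega), sub_zero]

theorem IsTriangular.dunkl_pow {s : Multiset ℕ} {f : MvPowerSeries ℕ F}
    (hf : IsTriangular s (fun _ => 1) f) (k : ℕ) :
    IsTriangular s (fun u => algebraMap (Polynomial ℚ) F (diagPoly s k u)) ((JackSym.dunkl ^ k) f) := by
  induction k with
  | zero => simpa [diagPoly] using hf
  | succ k ih =>
    have h := ih.dunkl
    rw [pow_succ', Module.End.mul_apply]
    convert h using 2 with u
    rw [diagPoly, map_add, map_mul, map_mul, map_natCast, RatFunc.algebraMap_X, α, map_multiset_sum,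
      Multiset.map_map]
    congr 2
    refine Multiset.map_congr rfl fun v _ => ?_
    simp only [Function.comp_apply]
    split_ifs <;> simp

/-- The diagonal coefficient of `moment k` at the monomial symmetric function of `s`. -/
noncomputable def momentEigenvalue (k : ℕ) (s : Multiset ℕ) : F :=
  algebraMap (Polynomial ℚ) F (diagPoly s k 0)

/-- A moment is again symmetric, so its coefficients can be read at monomials free of `x₀`, where
the diagonal value is the one at `u = 0`. -/
theorem moment_triangular {s : Multiset ℕ} {f : SymFun}
    (hf : IsTriangular s (fun _ => 1) (toSeries f)) (k : ℕ) :
    IsTriangular s (fun _ => momentEigenvalue k s) (toSeries (moment k f)) := by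
  have h := hf.dunkl_pow k
  have hrep : ∀ d : ℕ →₀ ℕ, ∃ e : ℕ →₀ ℕ, e 0 = 0 ∧ exps e = exps d ∧
      coeff d (toSeries (moment k f)) = coeff e ((JackSym.dunkl ^ k) (toSeries f)) := by
    intro d
    obtain ⟨e, he, hed⟩ := exists_exps_eq (exps d) (zero_notMem_exps d)
    exact ⟨e, he, hed, by rw [← coeff_toSeries_moment k f e he, coeff_toSeries, coeff_toSeries, hed]⟩
  refine ⟨fun d hd => ?_, fun d hd => ?_⟩
  · obtain ⟨e, -, hed, hc⟩ := hrep d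
    rw [hc] at hd
    exact hed ▸ h.1 e hd
  · obtain ⟨e, he, hed, hc⟩ := hrep d
    rw [hc, h.2 e (hed.trans hd), he]
    rfl

theorem exists_momentEigenvalue_ne {s t : Multiset ℕ} (hs : 0 ∉ s) (ht : 0 ∉ t) (h : s ≠ t) :
    ∃ k, momentEigenvalue k s ≠ momentEigenvalue k t := by
  by_contra! hc
  refine h (eq_of_sum_pow_eq hs ht fun k hk => ?_)
  rw [← coeff_diagPoly_zero s hs k hk, ← coeff_diagPoly_zero t ht k hk,
    RatFunc.algebraMap_injective ℚ (hc (k + 1))]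

theorem momentEigenvalue_three_ne {s t : Multiset ℕ} (hs : 0 ∉ s) (ht : 0 ∉ t) (h : Dom s t)
    (hne : s ≠ t) : momentEigenvalue 3 s ≠ momentEigenvalue 3 t := by
  intro hc
  have h1 := congrArg (fun q => Polynomial.coeff q 2) (RatFunc.algebraMap_injective ℚ hc)
  simp only [coeff_diagPoly_zero s hs 2 (by omega), coeff_diagPoly_zero t ht 2 (by omega)] at h1
  have h2 := sum_sq_lt_of_dom hs ht h hne
  have h3 : ∀ r : Multiset ℕ, (r.map fun v : ℕ => (v : ℚ) ^ 2).sum = ((r.map (· ^ 2)).sum : ℕ) := by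
    intro r
    rw [Nat.cast_multiset_sum, Multiset.map_map]
    simp
  rw [h3, h3] at h1
  exact h2.ne (by exact_mod_cast h1)

/-! ### Orthogonal unitriangular families -/

section Orthogonal

variable {K V I κ : Type*} [Field K] [AddCommGroup V] [Module K V]

/-- The span of the `m μ` with `μ` below `lam`. -/
def lower (K : Type*) {V I : Type*} [Field K] [AddCommGroup V] [Module K V] (m : I → V)
    (lt : I → I → Prop) (lam : I) : Submodule K V :=
  Submodule.span K (m '' {μ | lt μ lam})

variable {m : I → V} {lt : I → I → Prop}

theorem mem_lower {μ lam : I} (h : lt μ lam) : m μ ∈ lower K m lt lam :=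
  Submodule.subset_span ⟨μ, h, rfl⟩

variable [IsTrans I lt]

theorem lower_mono {μ lam : I} (h : lt μ lam) : lower K m lt μ ≤ lower K m lt lam :=
  Submodule.span_mono (Set.image_mono fun _ hν => _root_.trans hν h)

theorem mem_lower_of_sub_mem {μ lam : I} (h : lt μ lam) {f : V} (hf : f - m μ ∈ lower K m lt μ) :
    f ∈ lower K m lt lam := by
  rw [← sub_add_cancel f (m μ)]
  exact add_mem (lower_mono h hf) (mem_lower h)

theorem lower_le_span [IsWellFounded I lt] {P : I → V} (lam : I)
    (hP : ∀ μ, lt μ lam → P μ - m μ ∈ lower K m lt μ) :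
    lower K m lt lam ≤ Submodule.span K (P '' {μ | lt μ lam}) := by
  induction lam using IsWellFounded.induction lt with
  | _ lam ih =>
    refine Submodule.span_le.2 ?_
    rintro _ ⟨μ, hμ, rfl⟩
    have h1 := ih μ hμ (fun ν hν => hP ν (_root_.trans hν hμ)) (hP μ hμ)
    have h2 : Submodule.span K (P '' {ν | lt ν μ}) ≤ Submodule.span K (P '' {ν | lt ν lam}) :=
      Submodule.span_mono (Set.image_mono fun _ hν => _root_.trans hν hμ)
    rw [← sub_sub_cancel (P μ) (m μ)]
    exact sub_mem (Submodule.subset_span ⟨μ, hμ, rfl⟩) (h2 h1)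

variable {B : V →ₗ[K] V →ₗ[K] K}

/-- By unitriangularity the lower `P μ` span the lower `m μ`, so such a `g` is orthogonal to itself.
-/
theorem eq_zero_of_forall_orthogonal [IsWellFounded I lt] (hB : ∀ f, B f f = 0 → f = 0) {P : I → V}
    {lam : I} (hP : ∀ μ, lt μ lam → P μ - m μ ∈ lower K m lt μ) {g : V}
    (hg : g ∈ lower K m lt lam) (h : ∀ μ, lt μ lam → B g (P μ) = 0) : g = 0 := by
  have hle : Submodule.span K (P '' {μ | lt μ lam}) ≤ LinearMap.ker (B g) := by
    refine Submodule.span_le.2 ?_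
    rintro _ ⟨μ, hμ, rfl⟩
    exact h μ hμ
  exact hB g (hle (lower_le_span lam hP hg))

theorem orthogonal_of_eigenvalue_ne {T : Module.End K V} (hT : ∀ f g, B (T f) g = B f (T g))
    {a b : K} (hab : a ≠ b) {f g : V} (hf : T f = a • f) (hg : T g = b • g) : B f g = 0 := by
  have h := hT f g
  rw [hf, hg, map_smul, map_smul, LinearMap.smul_apply, smul_eq_mul, smul_eq_mul] at h
  have h' : (a - b) * B f g = 0 := by rw [sub_mul, h, sub_self]
  exact (mul_eq_zero.1 h').resolve_left (sub_ne_zero.2 hab)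

theorem apply_sub_smul_mem_lower {T : Module.End K V} {a : I → K}
    (hT : ∀ lam, T (m lam) - a lam • m lam ∈ lower K m lt lam) {lam : I} {f : V}
    (hf : f - m lam ∈ lower K m lt lam) : T f - a lam • f ∈ lower K m lt lam := by
  have hmap : lower K m lt lam ≤ (lower K m lt lam).comap T := by
    refine Submodule.span_le.2 ?_
    rintro _ ⟨μ, hμ, rfl⟩
    change T (m μ) ∈ lower K m lt lam
    rw [← sub_add_cancel (T (m μ)) (a μ • m μ)]
    exact add_mem (lower_mono hμ (hT μ)) (Submodule.smul_mem _ _ (mem_lower hμ))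
  have h1 : T (f - m lam) ∈ lower K m lt lam := hmap hf
  have h2 : T f - a lam • f =
      T (f - m lam) + (T (m lam) - a lam • m lam) - a lam • (f - m lam) := by
    rw [map_sub, smul_sub]
    abel
  rw [h2]
  exact sub_mem (add_mem h1 (hT lam)) (Submodule.smul_mem _ _ hf)

/-- Gram–Schmidt against the lower eigenvectors, which are mutually orthogonal, even when
incomparable, by their distinct joint eigenvalues. Then `T k f - a k lam • f` is a lower vector,
orthogonal to every lower eigenvector by self-adjointness, hence zero. Commutativity of the `T k`
never enters. -/
theorem exists_unitriangular_eigenvector [IsWellFounded I lt] (hB : ∀ f, B f f = 0 → f = 0)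
    (hfin : ∀ lam, {μ | lt μ lam}.Finite) (hm : ∀ lam, m lam ∉ lower K m lt lam)
    {T : κ → Module.End K V} (hTB : ∀ k f g, B (T k f) g = B f (T k g)) {a : κ → I → K}
    (hT : ∀ k lam, T k (m lam) - a k lam • m lam ∈ lower K m lt lam)
    (ha : ∀ lam μ, lam ≠ μ → ∃ k, a k lam ≠ a k μ) (lam : I) :
    ∃ f, f - m lam ∈ lower K m lt lam ∧ ∀ k, T k f = a k lam • f := by
  induction lam using IsWellFounded.induction lt with
  | _ lam ih =>
    have : ∀ μ, ∃ f, lt μ lam → f - m μ ∈ lower K m lt μ ∧ ∀ k, T k f = a k μ • f := fun μ => by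
      by_cases h : lt μ lam
      · obtain ⟨f, hf⟩ := ih μ h
        exact ⟨f, fun _ => hf⟩
      · exact ⟨0, fun h' => absurd h' h⟩
    choose P hP using this
    set f := m lam - ∑ μ ∈ (hfin lam).toFinset, (B (m lam) (P μ) / B (P μ) (P μ)) • P μ with hf_def
    have hf : f - m lam ∈ lower K m lt lam := by
      rw [hf_def, sub_sub_cancel_left]
      refine neg_mem (sum_mem fun μ hμ => Submodule.smul_mem _ _ ?_)
      have hμ' : lt μ lam := (hfin lam).mem_toFinset.1 hμ
      exact mem_lower_of_sub_mem hμ' (hP μ hμ').1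
    have horth : ∀ ν, lt ν lam → B f (P ν) = 0 := by
      intro ν hν
      have hne : B (P ν) (P ν) ≠ 0 := by
        intro h0
        have h1 := (hP ν hν).1
        rw [hB _ h0, zero_sub] at h1
        exact hm ν (neg_mem_iff.1 h1)
      rw [hf_def, map_sub, map_sum, LinearMap.sub_apply, LinearMap.sum_apply,
        Finset.sum_eq_single_of_mem ν ((hfin lam).mem_toFinset.2 hν), map_smul,
        LinearMap.smul_apply, smul_eq_mul, div_mul_cancel₀ _ hne, sub_self]
      intro μ hμ hμν
      have hμ' : lt μ lam := (hfin lam).mem_toFinset.1 hμ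
      obtain ⟨k, hk⟩ := ha μ ν hμν
      rw [map_smul, LinearMap.smul_apply, orthogonal_of_eigenvalue_ne (hTB k) hk
        ((hP μ hμ').2 k) ((hP ν hν).2 k), smul_zero]
    refine ⟨f, hf, fun k => ?_⟩
    rw [← sub_eq_zero]
    refine eq_zero_of_forall_orthogonal hB (fun μ hμ => (hP μ hμ).1)
      (apply_sub_smul_mem_lower (hT k) hf) fun μ hμ => ?_
    rw [map_sub, map_smul, LinearMap.sub_apply, LinearMap.smul_apply, hTB, (hP μ hμ).2 k, map_smul,
      horth μ hμ, smul_zero, smul_zero, sub_zero]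

theorem unitriangular_orthogonal_unique [IsWellFounded I lt] (hB : ∀ f, B f f = 0 → f = 0)
    {P Q : I → V} (hP : ∀ lam, P lam - m lam ∈ lower K m lt lam)
    (hQ : ∀ lam, Q lam - m lam ∈ lower K m lt lam)
    (hP' : ∀ lam μ, lam ≠ μ → B (P lam) (P μ) = 0) (hQ' : ∀ lam μ, lam ≠ μ → B (Q lam) (Q μ) = 0) :
    P = Q := by
  funext lam
  induction lam using IsWellFounded.induction lt with
  | _ lam ih =>
    rw [← sub_eq_zero]
    refine eq_zero_of_forall_orthogonal hB (fun μ _ => hP μ) (lam := lam) ?_ fun μ hμ => ?_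
    · rw [← sub_sub_sub_cancel_right _ _ (m lam)]
      exact sub_mem (hP lam) (hQ lam)
    · have hne : lam ≠ μ := by
        rintro rfl
        exact irrefl_of lt _ hμ
      rw [map_sub, LinearMap.sub_apply, hP' lam μ hne, ih μ hμ, hQ' lam μ hne, sub_zero]

/-- The leading term forces the eigenvalue of `f` to be `a lam`. Then `f - P lam` is a lower vector
in the same eigenspace, orthogonal to each lower `P μ` because `a μ` differs. Only comparable
indices need distinct eigenvalues. -/
theorem eq_of_unitriangular_eigenvector [IsWellFounded I lt] (hB : ∀ f, B f f = 0 → f = 0)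
    (hm : ∀ lam, m lam ∉ lower K m lt lam) {T : Module.End K V}
    (hTB : ∀ f g, B (T f) g = B f (T g)) {a : I → K}
    (hT : ∀ lam, T (m lam) - a lam • m lam ∈ lower K m lt lam)
    (ha : ∀ lam μ, lt μ lam → a lam ≠ a μ) {P : I → V}
    (hP : ∀ lam, P lam - m lam ∈ lower K m lt lam) (hPT : ∀ lam, T (P lam) = a lam • P lam)
    {lam : I} {f : V} (hf : f - m lam ∈ lower K m lt lam) {e : K} (he : T f = e • f) :
    f = P lam := by
  have hea : e = a lam := by
    by_contra hne
    have h1 := apply_sub_smul_mem_lower hT hf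
    rw [he, ← sub_smul, Submodule.smul_mem_iff _ (sub_ne_zero.2 hne)] at h1
    refine hm lam ?_
    rw [← sub_sub_cancel f (m lam)]
    exact sub_mem h1 hf
  rw [← sub_eq_zero]
  refine eq_zero_of_forall_orthogonal hB (fun μ _ => hP μ) (lam := lam) ?_ fun μ hμ => ?_
  · rw [← sub_sub_sub_cancel_right _ _ (m lam)]
    exact sub_mem hf (hP lam)
  · refine orthogonal_of_eigenvalue_ne hTB (ha lam μ hμ) ?_ (hPT μ)
    rw [map_sub, he, hPT, hea, smul_sub]

end Orthogonal

/-! ### Jack symmetric functions -/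

/-- The monomial symmetric functions as polynomials in the power sums. -/
noncomputable def monomialFun (lam : AllPartitions) : SymFun :=
  (exists_toSeries_eq_monomialSymm lam.2).choose

theorem toSeries_monomialFun (lam : AllPartitions) :
    toSeries (monomialFun lam) = monomialSymm lam.2 :=
  (exists_toSeries_eq_monomialSymm lam.2).choose_spec

/-- Strict dominance order on partitions. -/
def DomLT (μ lam : AllPartitions) : Prop := Dom μ.2.parts lam.2.parts ∧ μ.2.parts ≠ lam.2.parts

theorem DomLT.sum_sq_lt {μ lam : AllPartitions} (h : DomLT μ lam) :
    (μ.2.parts.map (· ^ 2)).sum < (lam.2.parts.map (· ^ 2)).sum :=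
  sum_sq_lt_of_dom (zero_notMem_parts _) (zero_notMem_parts _) h.1 h.2

instance : IsTrans AllPartitions DomLT where
  trans μ ν lam h h' := ⟨h.1.trans h'.1, fun he => by
    have h1 := h.sum_sq_lt.trans h'.sum_sq_lt
    rw [he] at h1
    exact lt_irrefl _ h1⟩

instance : IsWellFounded AllPartitions DomLT where
  wf := Subrelation.wf (fun h => DomLT.sum_sq_lt h)
    (measure fun lam : AllPartitions => (lam.2.parts.map (· ^ 2)).sum).wf

theorem parts_injective : Function.Injective fun lam : AllPartitions => lam.2.parts := by
  rintro ⟨n, lam⟩ ⟨n', μ⟩ h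
  obtain rfl : n = n' := by rw [← lam.parts_sum, ← μ.parts_sum]; exact congrArg _ h
  rw [show lam = μ from Nat.Partition.ext h]

theorem finite_domLT (lam : AllPartitions) : {μ | DomLT μ lam}.Finite := by
  refine (Set.finite_range fun μ : lam.1.Partition => (⟨lam.1, μ⟩ : AllPartitions)).subset ?_
  rintro ⟨n, μ⟩ h
  obtain rfl : n = lam.1 := by rw [← μ.parts_sum, ← lam.2.parts_sum]; exact h.1.1
  exact ⟨μ, rfl⟩

theorem coeff_monomialFun (lam : AllPartitions) (d : ℕ →₀ ℕ) [Decidable (exps d = lam.2.parts)] :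
    coeff d (toSeries (monomialFun lam)) = if exps d = lam.2.parts then 1 else 0 := by
  rw [toSeries_monomialFun, coeff_monomialSymm]

/-- Translates the span condition of the abstract argument into the coefficient condition for which
triangularity of the moments was proved. -/
theorem mem_lower_iff (lam : AllPartitions) (g : SymFun) : g ∈ lower F monomialFun DomLT lam ↔
    ∀ d, coeff d (toSeries g) ≠ 0 → Dom (exps d) lam.2.parts ∧ exps d ≠ lam.2.parts := by
  classical
  constructor
  · intro hg
    induction hg using Submodule.span_induction with
    | mem g hg =>
      obtain ⟨μ, hμ, rfl⟩ := hg
      intro d hd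
      rw [coeff_monomialFun] at hd
      have : exps d = μ.2.parts := by
        by_contra h
        exact hd (if_neg h)
      rw [this]
      exact hμ
    | zero => simp
    | add f g _ _ hf hg =>
      intro d hd
      by_cases h : coeff d (toSeries f) = 0
      · refine hg d fun h' => hd ?_
        rw [map_add, map_add, h, h', add_zero]
      · exact hf d h
    | smul c g _ hg =>
      intro d hd
      refine hg d fun h => hd ?_
      rw [map_smul, map_smul, h, smul_zero]
  · intro h
    have h1 : g = ∑ μ : lam.1.Partition, mcoeff g μ.parts • monomialFun ⟨lam.1, μ⟩ := by
      apply toSeries_injective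
      rw [map_sum, toSeries_eq_sum (n := lam.1) g fun d hd => (h d hd).1.1.trans lam.2.parts_sum]
      exact Finset.sum_congr rfl fun μ _ => by rw [map_smul, toSeries_monomialFun]
    rw [h1]
    refine sum_mem fun μ _ => ?_
    by_cases h0 : mcoeff g μ.parts = 0
    · rw [h0, zero_smul]
      exact zero_mem _
    · refine Submodule.smul_mem _ _ (mem_lower ?_)
      obtain ⟨d, -, hd⟩ := exists_exps_eq μ.parts (zero_notMem_parts μ)
      have := h d (by rwa [coeff_toSeries, hd])
      rwa [hd] at this

theorem sub_smul_monomialFun_mem_lower_iff (lam : AllPartitions) (f : SymFun) (c : F) :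
    f - c • monomialFun lam ∈ lower F monomialFun DomLT lam ↔
      IsTriangular lam.2.parts (fun _ => c) (toSeries f) := by
  classical
  have hcoeff : ∀ d, coeff d (toSeries (f - c • monomialFun lam)) =
      coeff d (toSeries f) - if exps d = lam.2.parts then c else 0 := by
    intro d
    rw [map_sub, map_sub, map_smul, map_smul, coeff_monomialFun, smul_eq_mul, mul_ite, mul_one,
      mul_zero]
  rw [mem_lower_iff]
  simp only [hcoeff]
  constructor
  · refine fun h => ⟨fun d hd => ?_, fun d hd => ?_⟩
    · by_cases he : exps d = lam.2.parts
      · rw [he]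
        exact Dom.refl _
      · exact (h d (by rwa [if_neg he, sub_zero])).1
    · by_contra hne
      exact (h d (by rwa [if_pos hd, sub_ne_zero])).2 hd
  · intro h d hd
    by_cases he : exps d = lam.2.parts
    · rw [if_pos he, h.2 d he, sub_self] at hd
      exact absurd rfl hd
    · rw [if_neg he, sub_zero] at hd
      exact ⟨h.1 d hd, he⟩

theorem isUnitriangular_iff_sub_mem_lower (lam : AllPartitions) (f : SymFun) :
    IsUnitriangular lam.2 f ↔ f - monomialFun lam ∈ lower F monomialFun DomLT lam := by
  have := sub_smul_monomialFun_mem_lower_iff lam f 1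
  rw [one_smul] at this
  rw [this, isUnitriangular_iff]
  rfl

theorem monomialFun_notMem_lower (lam : AllPartitions) :
    monomialFun lam ∉ lower F monomialFun DomLT lam := by
  classical
  intro h
  obtain ⟨d, -, hd⟩ := exists_exps_eq lam.2.parts (zero_notMem_parts _)
  refine ((mem_lower_iff lam _).1 h d ?_).2 hd
  rw [coeff_monomialFun, if_pos hd]
  exact one_ne_zero

theorem moment_monomialFun (k : ℕ) (lam : AllPartitions) :
    moment k (monomialFun lam) - momentEigenvalue k lam.2.parts • monomialFun lam ∈
      lower F monomialFun DomLT lam := by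
  refine (sub_smul_monomialFun_mem_lower_iff lam _ _).2 (moment_triangular ?_ k)
  rw [← sub_smul_monomialFun_mem_lower_iff lam, one_smul, sub_self]
  exact zero_mem _

theorem exists_jack (lam : AllPartitions) :
    ∃ f, f - monomialFun lam ∈ lower F monomialFun DomLT lam ∧
      ∀ k, moment k f = momentEigenvalue k lam.2.parts • f :=
  exists_unitriangular_eigenvector jackForm_anisotropic finite_domLT monomialFun_notMem_lower
    jackForm_moment moment_monomialFun (fun _ _ h => exists_momentEigenvalue_ne
      (zero_notMem_parts _) (zero_notMem_parts _) (parts_injective.ne h)) lam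

/-- The Jack symmetric functions. -/
noncomputable def jack (lam : AllPartitions) : SymFun := (exists_jack lam).choose

theorem jack_sub_mem_lower (lam : AllPartitions) :
    jack lam - monomialFun lam ∈ lower F monomialFun DomLT lam :=
  (exists_jack lam).choose_spec.1

theorem moment_jack (k : ℕ) (lam : AllPartitions) :
    moment k (jack lam) = momentEigenvalue k lam.2.parts • jack lam :=
  (exists_jack lam).choose_spec.2 k

theorem isJackFamily_jack : IsJackFamily jack where
  unitriangular lam := (isUnitriangular_iff_sub_mem_lower lam _).2 (jack_sub_mem_lower lam)
  orthogonal lam μ h := by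
    obtain ⟨k, hk⟩ := exists_momentEigenvalue_ne (zero_notMem_parts lam.2) (zero_notMem_parts μ.2)
      (parts_injective.ne h)
    exact orthogonal_of_eigenvalue_ne (B := jackForm) (jackForm_moment k) hk (moment_jack k lam)
      (moment_jack k μ)

theorem IsJackFamily.eq_jack {P : AllPartitions → SymFun} (hP : IsJackFamily P) : P = jack :=
  unitriangular_orthogonal_unique (B := jackForm) jackForm_anisotropic
    (fun lam => (isUnitriangular_iff_sub_mem_lower lam _).1 (hP.unitriangular lam))
    jack_sub_mem_lower hP.orthogonal isJackFamily_jack.orthogonal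

theorem jack_ne_zero (lam : AllPartitions) : jack lam ≠ 0 := by
  intro h
  have := jack_sub_mem_lower lam
  rw [h, zero_sub] at this
  exact monomialFun_notMem_lower lam (neg_mem_iff.1 this)

end JackSym

/-- The Jack symmetric functions `P_λ(α)` are well defined, and `f = P_λ(α)` if and only if `f` is
unitriangular in the monomial basis and an eigenvector of `D(α)`. -/
theorem theorem5p1 :
    (∃! P : JackSym.AllPartitions → JackSym.SymFun, JackSym.IsJackFamily P) ∧
    ∀ P : JackSym.AllPartitions → JackSym.SymFun, JackSym.IsJackFamily P →
      ∀ (n : ℕ) (lam : n.Partition) (f : JackSym.SymFun),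
        f = P ⟨n, lam⟩ ↔
          JackSym.IsUnitriangular lam f ∧
          ∃ e : JackSym.F, Module.End.HasEigenvector JackSym.D e f := by
  refine ⟨⟨JackSym.jack, JackSym.isJackFamily_jack, fun P hP => hP.eq_jack⟩, ?_⟩
  intro P hP n lam f
  rw [hP.eq_jack, JackSym.D_eq_moment]
  constructor
  · rintro rfl
    refine ⟨JackSym.isJackFamily_jack.unitriangular ⟨n, lam⟩, _,
      Module.End.hasEigenvector_iff.2 ⟨Module.End.mem_eigenspace_iff.2
        (JackSym.moment_jack 3 ⟨n, lam⟩), JackSym.jack_ne_zero _⟩⟩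
  · rintro ⟨hf, e, he⟩
    exact JackSym.eq_of_unitriangular_eigenvector JackSym.jackForm_anisotropic
      JackSym.monomialFun_notMem_lower (JackSym.jackForm_moment 3) (JackSym.moment_monomialFun 3)
      (fun lam μ h => (JackSym.momentEigenvalue_three_ne (JackSym.zero_notMem_parts _)
        (JackSym.zero_notMem_parts _) h.1 h.2).symm)
      JackSym.jack_sub_mem_lower (JackSym.moment_jack 3)
      ((JackSym.isUnitriangular_iff_sub_mem_lower ⟨n, lam⟩ f).1 hf)
      (Module.End.mem_eigenspace_iff.1 he.1)
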